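/- **Setting.** A federated control problem consists of finite non-empty sets $\mathcal S$ (states) and $\mathcal A$ (actions), rewards $\mathcal R(s,a)\in[0,1]$, transition probabilities $\mathcal P(\cdot\mid s,a)$, a discount factor $\gamma\in[0,1)$, and regions $\mathcal S_1,\dots,\mathcal S_N\subseteq\mathcal S$ with $\bigcup_k\mathcal S_k=\mathcal S$. Let $Q^\star(s,a)=\max_\pi Q^\pi(s,a)$ be the optimal Q function of the MDP, $N(s)=\#\{k: s\in\mathcal S_k\}$ and $N_{\min}=\min_s N(s)$. **Algorithm (FedQ-SynQ).** Given $Q_0$, a constant step size $\eta$, a local period $E$ and a number of rounds $R$, put $T=ER$. In round $r=0,\dots,R-1$ every agent $k$ starts from $Q_{rE,k}=Q_r$ and performs $E$ local steps: for $t=rE+1,\dots,(r+1)E$ it draws, for every $(s,a)\in\mathcal S_k\times\mathcal A$, a next state $s_{t,k}(s,a)\sim\mathcal P(\cdot\mid s,a)$ (all draws are independent) and sets $Q_{t,k}(s,a)=(1-\eta)Q_{t-1,k}(s,a)+\eta\big(\mathcal R(s,a)+\gamma\max_{a'}Q_{t-1,k}(s_{t,k}(s,a),a')\big)$ for $s\in\mathcal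 S_k$, and $Q_{t,k}(s,a)=Q_{t-1,k}(s,a)$ for $s\notin\mathcal S_k$. Then $Q_{r+1}(s,a)=\frac1{N(s)}\sum_{k:\,s\in\mathcal S_k}Q_{(r+1)E,k}(s,a)$. The output is $Q_R$. Agent $k$ uses $|\mathcal S_k||\mathcal A|T$ samples. **Theorem.** Let $\delta\in(0,1)$, $\varepsilon\in(0,\frac1{1-\gamma})$ and $0\le Q_0(s,a)\le\frac1{1-\gamma}$ for all $(s,a)$. (1) Write $L=\log\frac{6|\mathcal S||\mathcal A|TN}{\delta}$. If $E,R\ge1$, $0<\eta\le1$ and $$T\ge\frac{1296}{N_{\min}\varepsilon^2(1-\gamma)^5}\Big(\log\tfrac{10}{\varepsilon(1-\gamma)^2}\Big)^2L,\qquad \frac{\big(\log\frac{10}{\varepsilon(1-\gamma)^2}\big)^2}{(1-\gamma)T}\le\eta\le\frac{N_{\min}\varepsilon^2(1-\gamma)^4}{1296\,L},$$ $$E\le1+\frac1{1.01\,\eta}\min\Big\{\frac{1-\gamma}{4\gamma},\frac1{N_{\min}}\Big\}$$ (with $\frac{1-\gamma}{4\gamma}=\infty$ for $\gamma=0$), then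 with probability at least $1-\delta$ the output satisfies $\|Q^\star-Q_R\|_\infty\le\varepsilon$. (2) There are $\eta,E,R$, depending only on $|\mathcal S|,|\mathcal A|,N,N_{\min},\gamma,\varepsilon,\delta$, which satisfy all conditions of (1) (so that $\|Q^\star-Q_R\|_\infty\le\varepsilon$ with probability at least $1-\delta$) and $$T=\widetilde O\Big(\max\Big\{\frac{1}{N_{\min}\varepsilon^2(1-\gamma)^5},\frac1{1-\gamma}\Big\}\Big),\qquad R=\widetilde O\Big(\frac1{1-\gamma}\max\Big\{\frac1{1-\gamma},N_{\min}\Big\}\Big),$$ $$\eta=\widetilde\Omega\big(\min\{N_{\min}\varepsilon^2(1-\gamma)^4,1\}\big),\qquad E=\widetilde\Omega\Big(\frac{1}{N_{\min}\varepsilon^2(1-\gamma)^4}\min\Big\{1-\gamma,\frac1{N_{\min}}\Big\}\Big),$$ and agent $k$ uses $\widetilde O\big(|\mathcal S_k||\mathcal A|\max\{\frac1{N_{\min}\varepsilon^2(1-\gamma)^5},\frac1{1-\gamma}\}\big)$ samples. In particular, whenever $N_{\min}\varepsilon^2(1-\gamma)^4\le1$, one has $T=\widetilde O\big(\frac1{N_{\min}\varepsilon^2(1-\gamma)^5}\big)$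 and agent $k$ uses $\widetilde O\big(\frac{|\mathcal S_k||\mathcal A|}{N_{\min}\varepsilon^2(1-\gamma)^5}\big)$ samples. Here $\widetilde O$ and $\widetilde\Omega$ hide an absolute constant and a fixed power of $\log\frac{10|\mathcal S||\mathcal A|N}{\delta\varepsilon(1-\gamma)^2}$. -/

import Mathlib

open MeasureTheory ProbabilityTheory

universe u v w

noncomputable section

/-- A (finite, discounted) federated control problem: an MDP with rewards in `[0, 1]` and
discount factor `γ ∈ [0, 1)`, together with `N` restricted regions that cover the state space. -/
structure FederatedMDP (S : Type u) (A : Type v) [Fintype S] [Fintype A] (N : ℕ) where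
  /-- the reward function -/
  reward : S → A → ℝ
  /-- `trans s a s'` is the probability of moving to `s'` from `s` under the action `a` -/
  trans : S → A → S → ℝ
  /-- the discount factor -/
  γ : ℝ
  /-- `region k` is the set of states that agent `k` has access to -/
  region : Fin N → Finset S
  reward_mem : ∀ s a, reward s a ∈ Set.Icc (0 : ℝ) 1
  trans_mem : ∀ s a, trans s a ∈ stdSimplex ℝ S
  γ_mem : γ ∈ Set.Ico (0 : ℝ) 1
  cover : ∀ s, ∃ k, s ∈ region k

/-- Stationary randomized policies: `π s a` is the probability of playing `a` in state `s`. -/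
def Policy (S : Type u) (A : Type v) [Fintype A] : Type (max u v) :=
  {π : S → A → ℝ // ∀ s, π s ∈ stdSimplex ℝ A}

namespace FederatedMDP

variable {S : Type u} {A : Type v} [Fintype S] [Fintype A] {N : ℕ}

open Classical in
/-- The law of the state-action pair `(s_t, a_t)` when `s_0 = s`, `a_0 = a`, the states move
according to the transition dynamics and, from time `1` on, actions are drawn from `π`. -/
def stateActionLaw (M : FederatedMDP S A N) (π : Policy S A) (s : S) (a : A) : ℕ → S → A → ℝ
  | 0 => fun s' a' => if s' = s ∧ a' = a then 1 else 0
  | t + 1 => fun s' a' =>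
      (∑ s₁, ∑ a₁, M.stateActionLaw π s a t s₁ a₁ * M.trans s₁ a₁ s') * π.1 s' a'

/-- `Q^π(s, a)`, the expected discounted cumulative reward of `π` started at `(s, a)`. -/
def qValue (M : FederatedMDP S A N) (π : Policy S A) (s : S) (a : A) : ℝ :=
  ∑' t : ℕ, M.γ ^ t * ∑ s', ∑ a', M.stateActionLaw π s a t s' a' * M.reward s' a'

/-- The optimal Q function `Q⋆(s, a) = max_π Q^π(s, a)`. -/
def qStar (M : FederatedMDP S A N) : S → A → ℝ :=
  fun s a => ⨆ π : Policy S A, M.qValue π s a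

open Classical in
/-- `N(s)`, the number of regions that contain `s`. -/
def agentCount (M : FederatedMDP S A N) (s : S) : ℕ :=
  (Finset.univ.filter fun k => s ∈ M.region k).card

/-- `N_min = min_s N(s)`. -/
def minCount [Nonempty S] (M : FederatedMDP S A N) : ℕ :=
  Finset.univ.inf' Finset.univ_nonempty M.agentCount

/-- The value function `V(s) = max_a Q(s, a)` attached to a Q function. -/
def maxValue [Nonempty A] (Q : S → A → ℝ) (s : S) : ℝ :=
  Finset.univ.sup' Finset.univ_nonempty (Q s)

/-- The state-action pairs that agent `k` has to sample in one local iteration. -/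
abbrev LocalPair (M : FederatedMDP S A N) (k : Fin N) : Type (max u v) :=
  {s // s ∈ M.region k} × A

/-- The slots of one iteration of all agents: an agent and one of its state-action pairs. -/
abbrev Slot (M : FederatedMDP S A N) : Type (max u v) :=
  (k : Fin N) × M.LocalPair k

open Classical in
/-- One step of synchronous Q-learning of agent `k` with step size `η`, where `y (s, a)` is the
sampled next state of `(s, a)`. Only the entries in the region of the agent are updated, so that
the values outside are those of the last communication round. -/
def localStep [Nonempty A] (M : FederatedMDP S A N) (η : ℝ) (k : Fin N)
    (y : M.LocalPair k → S) (Q : S → A → ℝ) : S → A → ℝ :=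
  fun s a =>
    if h : s ∈ M.region k then
      (1 - η) * Q s a + η * (M.reward s a + M.γ * maxValue Q (y (⟨s, h⟩, a)))
    else Q s a

/-- The Q function of agent `k` after `n` local steps from `Q`, with the sampled next states
`y 0, y 1, …`. -/
def localRun [Nonempty A] (M : FederatedMDP S A N) (η : ℝ) (k : Fin N)
    (y : ℕ → M.LocalPair k → S) (Q : S → A → ℝ) : ℕ → S → A → ℝ
  | 0 => Q
  | n + 1 => M.localStep η k (y n) (M.localRun η k y Q n)

open Classical in
/-- Aggregation: at `s`, average the local Q functions of the agents whose region contains `s`. -/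
def aggregate (M : FederatedMDP S A N) (Qs : Fin N → S → A → ℝ) : S → A → ℝ :=
  fun s a => (1 / (M.agentCount s : ℝ)) * ∑ k, if s ∈ M.region k then Qs k s a else 0

/-- The global Q function of FedQ-SynQ after a number of communication rounds, with step size `η`
and `E` local steps per round. Here `x (t, k, s, a)` is the next state that agent `k` samples for
`(s, a)` at iteration `t`, and local step `e` of round `r` is iteration `r * E + e`. -/
def fedQSynQ [Nonempty A] (M : FederatedMDP S A N) (η : ℝ) (E : ℕ) (x : ℕ × M.Slot → S)
    (Q₀ : S → A → ℝ) : ℕ → S → A → ℝ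
  | 0 => Q₀
  | r + 1 => M.aggregate fun k =>
      M.localRun η k (fun e p => x (r * E + e, ⟨k, p⟩)) (M.fedQSynQ η E x Q₀ r) E

/-- The number of samples that agent `k` draws in `T` iterations: one for each of its state-action
pairs in each iteration. -/
def samplesUsed (M : FederatedMDP S A N) (k : Fin N) (T : ℕ) : ℕ :=
  Fintype.card (Fin T × M.LocalPair k)

/-- `X` is a family of independent samples from the generative model: `X (t, k, s, a)` has the law
`trans s a`. -/
structure IsSampleFamily [MeasurableSpace S] (M : FederatedMDP S A N)
    {Ω : Type w} [MeasurableSpace Ω] (μ : Measure Ω) (X : ℕ × M.Slot → Ω → S) : Prop where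
  measurable : ∀ i, Measurable (X i)
  indep : iIndepFun X μ
  law : ∀ (t : ℕ) (k : Fin N) (p : M.LocalPair k) (s' : S),
    μ.real (X (t, ⟨k, p⟩) ⁻¹' {s'}) = M.trans p.1.1 p.2 s'

/-- With probability at least `1 - δ`, the output `Q_R` of FedQ-SynQ satisfies
`‖Q⋆ - Q_R‖_∞ ≤ ε` (the norm on `S → A → ℝ` is the maximum norm). -/
def ReachesAccuracy [Nonempty A] [MeasurableSpace S] (M : FederatedMDP S A N)
    (Q₀ : S → A → ℝ) (ε δ η : ℝ) (E R : ℕ) : Prop :=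
  ∀ (Ω : Type w) [MeasurableSpace Ω] (μ : Measure Ω) [IsProbabilityMeasure μ]
    (X : ℕ × M.Slot → Ω → S), M.IsSampleFamily μ X →
    1 - δ ≤ μ.real {ω | ‖M.qStar - M.fedQSynQ η E (fun i => X i ω) Q₀ R‖ ≤ ε}

end FederatedMDP

/-- The requirements on the step size `η`, the local period `E` and the number of rounds `R`
(with `T = E R`), for `nS` states, `nA` actions, `N` agents, at least `Nmin` agents per state,
discount factor `γ`, accuracy `ε` and failure probability `δ`. The last two fields say
`E ≤ 1 + (1 / (1.01 η)) min {(1 - γ) / (4 γ), 1 / Nmin}`, the first entry being `∞` if `γ = 0`. -/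
structure AdmissibleParams (nS nA N Nmin : ℕ) (γ ε δ η : ℝ) (E R : ℕ) : Prop where
  eta_pos : 0 < η
  eta_le_one : η ≤ 1
  E_pos : 1 ≤ E
  R_pos : 1 ≤ R
  T_ge : 1296 / (Nmin * ε ^ 2 * (1 - γ) ^ 5) * Real.log (10 / (ε * (1 - γ) ^ 2)) ^ 2
      * Real.log (6 * nS * nA * ((E * R : ℕ) : ℝ) * N / δ) ≤ ((E * R : ℕ) : ℝ)
  eta_le : η ≤ 1 / 1296 * (Nmin * ε ^ 2 * (1 - γ) ^ 4)
      * (Real.log (6 * nS * nA * ((E * R : ℕ) : ℝ) * N / δ))⁻¹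
  eta_ge : Real.log (10 / (ε * (1 - γ) ^ 2)) ^ 2 / ((1 - γ) * ((E * R : ℕ) : ℝ)) ≤ η
  E_le_gamma : 1.01 * η * ((E : ℝ) - 1) * (4 * γ) ≤ 1 - γ
  E_le_Nmin : 1.01 * η * ((E : ℝ) - 1) * Nmin ≤ 1

/-- The logarithmic factor that is hidden in the notation `Õ`. -/
def logFactor (nS nA N : ℕ) (γ ε δ : ℝ) : ℝ :=
  Real.log (10 * nS * nA * N / (δ * ε * (1 - γ) ^ 2))

end

/-!
Write `h = 1 - γ`, `V` for the value function of `Q⋆`, `q = (1 - η) ^ E` and `Lδ`, `Lε` for the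
logarithms of `6 |S| |A| T N / δ` and `10 / (ε h²)`.

**Bellman equation.** The state-action chain of a policy is given by powers of a stochastic matrix,
so `Q^π` solves its Bellman equation. The optimality operator is a contraction; its fixed point
dominates every `Q^π` and is attained by its greedy policy, hence equals `Q⋆` (`qStar_eq`). In
particular `V` takes values in `[0, 1 / h]`.

**Error decomposition.** By the Bellman equation, the error `Q⋆ - Q` of an agent after some local
steps is the discounted error at the start of the round, plus a discounted sum of the centered
sampling errors `P V - V(y)`, plus `γ` times discounted errors at the sampled next states. If all
local noises of fewer than `E` steps are at most `b`, the local errors exceed the error `d` at the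
start of the round by at most `4 b / 3`, since `γ η (E - 1) ≤ 1 / 4`. Averaging over the agents and
unrolling over the rounds gives
`d r ≤ q ^ r d 0 + b + γ ∑_{i < r} q ^ (r - 1 - i) (1 - q) (d i + 4 b / 3)`, when
the averaged noises are at most `b` as well. This renewal inequality (`renewal_bound`) yields
`d R ≤ (b + 4 γ b / 3) / h + (1 - (1 - q) h) ^ R d 0` (`norm_qStar_sub_fedQSynQ_le`).

**Concentration.** Both kinds of noise are weighted sums of independent sampling errors, and the
squared weights sum to at most `η / Nmin`: for the averaged noise because averaging over `N(s)`
agents divides the variance, for the local noise because `η (E - 1) ≤ 1 / Nmin`. By Hoeffding's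
inequality each exceeds `b = ε h / 4` with probability at most `2 exp (-Lδ)`, and a union bound over
at most `3 |S| |A| T N` such events costs `δ` in total. On the remaining event the noise contributes
at most `7 ε / 12`. As `1 - q ≥ η E / 2`, the initial error contributes at most
`exp (-η T h / 2) / h ≤ exp (-Lε² / 2) / h ≤ exp (-Lε) / h ≤ ε / 10`.

**Choice of the parameters.** With `m = Nmin ε² h⁴`, `Λ` the logarithmic factor and `K = 10⁵`, take
`η = min m 1 / (K Λ)`, the largest `E` with `1.01 η (E - 1) ≤ min h (1 / Nmin) / 4`, and `R` such
that `T = E R` is between `T₀ = K Λ³ / (h min m 1)` and `2 T₀`. Then `η h T₀ = Λ²`, and the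
logarithm `Lδ` is at most `K Λ / 1296` (`log_sampleCount_le`), which gives all the conditions.
-/

noncomputable section

/-! ### Finite maxima and averages -/

namespace FederatedMDP

variable {S : Type u} {A : Type v} [Fintype A]

lemma le_maxValue [Nonempty A] (Q : S → A → ℝ) (s : S) (a : A) : Q s a ≤ maxValue Q s :=
  Finset.le_sup' (Q s) (Finset.mem_univ a)

lemma maxValue_le [Nonempty A] {Q : S → A → ℝ} {s : S} {c : ℝ} (h : ∀ a, Q s a ≤ c) :
    maxValue Q s ≤ c :=
  Finset.sup'_le _ _ fun a _ => h a

lemma exists_eq_maxValue [Nonempty A] (Q : S → A → ℝ) (s : S) : ∃ a, maxValue Q s = Q s a := by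
  obtain ⟨a, -, h⟩ := Finset.exists_mem_eq_sup' Finset.univ_nonempty (Q s)
  exact ⟨a, h⟩

/-- The maximum over the actions is nonexpansive. -/
lemma abs_maxValue_sub_le [Nonempty A] {Q Q' : S → A → ℝ} {s : S} {c : ℝ}
    (h : ∀ a, |Q s a - Q' s a| ≤ c) : |maxValue Q s - maxValue Q' s| ≤ c := by
  have key : ∀ a, Q s a ≤ c + maxValue Q' s ∧ Q' s a ≤ c + maxValue Q s := fun a => by
    have := abs_le.1 (h a)
    have := le_maxValue Q s a
    have := le_maxValue Q' s a
    constructor <;> linarith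
  have h1 := maxValue_le fun a => (key a).1
  have h2 := maxValue_le fun a => (key a).2
  exact abs_le.2 ⟨by linarith, by linarith⟩

variable [Fintype S] {N : ℕ}

lemma abs_apply_le_norm (Q : S → A → ℝ) (s : S) (a : A) : |Q s a| ≤ ‖Q‖ :=
  (norm_le_pi_norm (Q s) a).trans (norm_le_pi_norm Q s)

lemma norm_le_of_abs_le {Q : S → A → ℝ} {c : ℝ} (hc : 0 ≤ c) (h : ∀ s a, |Q s a| ≤ c) :
    ‖Q‖ ≤ c :=
  (pi_norm_le_iff_of_nonneg hc).2 fun s => (pi_norm_le_iff_of_nonneg hc).2 fun a => h s a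

/-- An average with respect to a probability vector is at most any bound on the entries. -/
lemma sum_mul_le_of_mem_stdSimplex {ι : Type*} [Fintype ι] {p : ι → ℝ} (hp : p ∈ stdSimplex ℝ ι)
    {f : ι → ℝ} {c : ℝ} (h : ∀ i, f i ≤ c) : ∑ i, p i * f i ≤ c := by
  calc ∑ i, p i * f i ≤ ∑ i, p i * c :=
        Finset.sum_le_sum fun i _ => mul_le_mul_of_nonneg_left (h i) (hp.1 i)
    _ = c := by rw [← Finset.sum_mul, hp.2, one_mul]

lemma le_sum_mul_of_mem_stdSimplex {ι : Type*} [Fintype ι] {p : ι → ℝ} (hp : p ∈ stdSimplex ℝ ι)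
    {f : ι → ℝ} {c : ℝ} (h : ∀ i, c ≤ f i) : c ≤ ∑ i, p i * f i := by
  calc c = ∑ i, p i * c := by rw [← Finset.sum_mul, hp.2, one_mul]
    _ ≤ ∑ i, p i * f i :=
        Finset.sum_le_sum fun i _ => mul_le_mul_of_nonneg_left (h i) (hp.1 i)

/-- A function on the state-action pairs all of whose upper bounds shrink by the factor `γ < 1`
is nonpositive. -/
lemma nonpos_of_forall_bound {γ : ℝ} (hγ : γ < 1) {f : S → A → ℝ}
    (h : ∀ D, (∀ s a, f s a ≤ D) → ∀ s a, f s a ≤ γ * D) (s : S) (a : A) : f s a ≤ 0 := by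
  obtain ⟨⟨s₀, a₀⟩, -, h₀⟩ := Finset.exists_max_image (Finset.univ : Finset (S × A))
    (fun p => f p.1 p.2) ⟨(s, a), Finset.mem_univ _⟩
  have hmax : ∀ s a, f s a ≤ f s₀ a₀ := fun s a => h₀ (s, a) (Finset.mem_univ _)
  have h1 := h _ hmax s₀ a₀
  have h2 := hmax s a
  nlinarith

/-! ### The Bellman equations -/

variable (M : FederatedMDP S A N)

/-- The transition matrix of the state-action chain under the policy `π`. -/
def policyMatrix (π : Policy S A) : Matrix (S × A) (S × A) ℝ :=
  fun z z' => M.trans z.1 z.2 z'.1 * π.1 z'.1 z'.2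

open Classical in
lemma stateActionLaw_eq_pow (π : Policy S A) (t : ℕ) (s : S) (a : A) (s' : S) (a' : A) :
    M.stateActionLaw π s a t s' a' = (M.policyMatrix π ^ t) (s, a) (s', a') := by
  induction t generalizing s' a' with
  | zero =>
    rw [stateActionLaw, pow_zero, Matrix.one_apply]
    simp only [Prod.mk.injEq, eq_comm]
  | succ t ih =>
    rw [stateActionLaw, pow_succ, Matrix.mul_apply, Fintype.sum_prod_type]
    simp_rw [Finset.sum_mul, ih, policyMatrix, mul_assoc]

lemma policyMatrix_row_mem (π : Policy S A) (z : S × A) :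
    M.policyMatrix π z ∈ stdSimplex ℝ (S × A) := by
  refine ⟨fun z' => mul_nonneg ((M.trans_mem z.1 z.2).1 _) ((π.2 z'.1).1 _), ?_⟩
  rw [Fintype.sum_prod_type]
  simp_rw [policyMatrix, ← Finset.mul_sum, (π.2 _).2, mul_one]
  exact (M.trans_mem z.1 z.2).2

/-- The expected reward at time `t` of the policy `π` started at the state-action pair `z`. -/
def expectedReward (π : Policy S A) (t : ℕ) (z : S × A) : ℝ :=
  ∑ s', ∑ a', M.stateActionLaw π z.1 z.2 t s' a' * M.reward s' a'

open Classical in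
lemma expectedReward_eq_pow (π : Policy S A) (t : ℕ) (z : S × A) :
    M.expectedReward π t z = ∑ z', (M.policyMatrix π ^ t) z z' * M.reward z'.1 z'.2 := by
  rw [expectedReward, Fintype.sum_prod_type]
  simp_rw [stateActionLaw_eq_pow]

lemma expectedReward_zero (π : Policy S A) (z : S × A) :
    M.expectedReward π 0 z = M.reward z.1 z.2 := by
  classical
  rw [expectedReward_eq_pow]
  simp [Matrix.one_apply]

lemma expectedReward_succ (π : Policy S A) (t : ℕ) (z : S × A) :
    M.expectedReward π (t + 1) z = ∑ z', M.policyMatrix π z z' * M.expectedReward π t z' := by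
  classical
  simp_rw [expectedReward_eq_pow, pow_succ', Matrix.mul_apply, Finset.sum_mul, Finset.mul_sum,
    mul_assoc]
  exact Finset.sum_comm

lemma expectedReward_mem (π : Policy S A) (t : ℕ) (z : S × A) :
    M.expectedReward π t z ∈ Set.Icc (0 : ℝ) 1 := by
  induction t generalizing z with
  | zero => rw [expectedReward_zero]; exact M.reward_mem _ _
  | succ t ih =>
    rw [expectedReward_succ]
    exact ⟨le_sum_mul_of_mem_stdSimplex (M.policyMatrix_row_mem π z) fun z' => (ih z').1,
      sum_mul_le_of_mem_stdSimplex (M.policyMatrix_row_mem π z) fun z' => (ih z').2⟩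

lemma summable_discounted (π : Policy S A) (z : S × A) :
    Summable fun t : ℕ => M.γ ^ t * M.expectedReward π t z :=
  Summable.of_nonneg_of_le
    (fun t => mul_nonneg (pow_nonneg M.γ_mem.1 t) (M.expectedReward_mem π t z).1)
    (fun t => mul_le_of_le_one_right (pow_nonneg M.γ_mem.1 t) (M.expectedReward_mem π t z).2)
    (summable_geometric_of_lt_one M.γ_mem.1 M.γ_mem.2)

lemma qValue_nonneg (π : Policy S A) (s : S) (a : A) : 0 ≤ M.qValue π s a :=
  tsum_nonneg fun t => mul_nonneg (pow_nonneg M.γ_mem.1 t) (M.expectedReward_mem π t (s, a)).1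

lemma qValue_le (π : Policy S A) (s : S) (a : A) : M.qValue π s a ≤ 1 / (1 - M.γ) := by
  rw [one_div, ← tsum_geometric_of_lt_one M.γ_mem.1 M.γ_mem.2]
  exact (M.summable_discounted π (s, a)).tsum_le_tsum
    (fun t => mul_le_of_le_one_right (pow_nonneg M.γ_mem.1 t) (M.expectedReward_mem π t (s, a)).2)
    (summable_geometric_of_lt_one M.γ_mem.1 M.γ_mem.2)

/-- The Bellman equation of a policy. -/
lemma qValue_eq (π : Policy S A) (s : S) (a : A) :
    M.qValue π s a = M.reward s a +
      M.γ * ∑ s', M.trans s a s' * ∑ a', π.1 s' a' * M.qValue π s' a' := by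
  have h0 : ∀ s a, M.qValue π s a = ∑' t : ℕ, M.γ ^ t * M.expectedReward π t (s, a) :=
    fun s a => rfl
  have hs : ∀ z ∈ (Finset.univ : Finset (S × A)), Summable fun t : ℕ =>
      M.policyMatrix π (s, a) z * (M.γ ^ t * M.expectedReward π t z) :=
    fun z _ => (M.summable_discounted π z).mul_left _
  rw [h0, (M.summable_discounted π (s, a)).tsum_eq_zero_add, expectedReward_zero, pow_zero, one_mul]
  congr 1
  calc ∑' t : ℕ, M.γ ^ (t + 1) * M.expectedReward π (t + 1) (s, a)
      = ∑' t : ℕ, M.γ * ∑ z, M.policyMatrix π (s, a) z * (M.γ ^ t * M.expectedReward π t z) := by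
        congr 1 with t
        rw [expectedReward_succ, pow_succ', mul_assoc, Finset.mul_sum]
        congr 2 with z
        ring
    _ = M.γ * ∑ z, M.policyMatrix π (s, a) z * M.qValue π z.1 z.2 := by
        rw [tsum_mul_left, Summable.tsum_finsetSum hs]
        simp_rw [tsum_mul_left, h0]
    _ = _ := by
        rw [Fintype.sum_prod_type]
        simp_rw [policyMatrix, mul_assoc, ← Finset.mul_sum]

/-- The Bellman optimality operator. -/
def optimalityOperator [Nonempty A] (Q : S → A → ℝ) : S → A → ℝ :=
  fun s a => M.reward s a + M.γ * ∑ s', M.trans s a s' * maxValue Q s'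

lemma exists_optimality_fixedPoint [Nonempty A] :
    ∃ Q : S → A → ℝ, M.optimalityOperator Q = Q := by
  have hc : ContractingWith ⟨M.γ, M.γ_mem.1⟩ M.optimalityOperator := by
    refine ⟨M.γ_mem.2, LipschitzWith.of_dist_le_mul fun Q Q' => ?_⟩
    rw [dist_eq_norm, dist_eq_norm]
    refine norm_le_of_abs_le (mul_nonneg M.γ_mem.1 (norm_nonneg _)) fun s a => ?_
    have h1 : M.optimalityOperator Q s a - M.optimalityOperator Q' s a =
        M.γ * ∑ s', M.trans s a s' * (maxValue Q s' - maxValue Q' s') := by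
      simp only [optimalityOperator, mul_sub, Finset.sum_sub_distrib]
      ring
    have h2 : ∀ s', |maxValue Q s' - maxValue Q' s'| ≤ ‖Q - Q'‖ := fun s' =>
      abs_maxValue_sub_le fun a' => abs_apply_le_norm (Q - Q') s' a'
    rw [Pi.sub_apply, Pi.sub_apply, h1, abs_mul, abs_of_nonneg M.γ_mem.1]
    refine mul_le_mul_of_nonneg_left (abs_le.2 ⟨?_, ?_⟩) M.γ_mem.1
    · exact le_sum_mul_of_mem_stdSimplex (M.trans_mem s a) fun s' => (abs_le.1 (h2 s')).1
    · exact sum_mul_le_of_mem_stdSimplex (M.trans_mem s a) fun s' => (abs_le.1 (h2 s')).2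
  exact ⟨_, hc.fixedPoint_isFixedPt⟩

/-- No policy beats a fixed point of the optimality operator. -/
lemma qValue_le_of_fixedPoint [Nonempty A] {Q : S → A → ℝ} (hQ : M.optimalityOperator Q = Q)
    (π : Policy S A) (s : S) (a : A) : M.qValue π s a ≤ Q s a := by
  refine sub_nonpos.1 (nonpos_of_forall_bound M.γ_mem.2 (f := fun s a => M.qValue π s a - Q s a)
    (fun D hD s a => ?_) s a)
  have h : ∀ s', ∑ a', π.1 s' a' * M.qValue π s' a' - maxValue Q s' ≤ D := fun s' => by
    rw [sub_le_iff_le_add']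
    refine sum_mul_le_of_mem_stdSimplex (π.2 s') fun a' => ?_
    linarith [hD s' a', le_maxValue Q s' a']
  have h1 := mul_le_mul_of_nonneg_left
    (sum_mul_le_of_mem_stdSimplex (M.trans_mem s a) h) M.γ_mem.1
  simp only [mul_sub, Finset.sum_sub_distrib] at h1
  have h2 : Q s a = _ := (congrFun (congrFun hQ s) a).symm
  rw [optimalityOperator] at h2
  linarith [M.qValue_eq π s a]

/-- The greedy policy of a fixed point of the optimality operator attains it. -/
lemma exists_policy_ge_of_fixedPoint [Nonempty A] {Q : S → A → ℝ}
    (hQ : M.optimalityOperator Q = Q) :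
    ∃ π : Policy S A, ∀ s a, Q s a ≤ M.qValue π s a := by
  classical
  choose g hg using exists_eq_maxValue Q
  let π : Policy S A := ⟨fun s => Pi.single (g s) 1, fun s => single_mem_stdSimplex ℝ (g s)⟩
  refine ⟨π, fun s a => sub_nonpos.1 (nonpos_of_forall_bound M.γ_mem.2
    (f := fun s a => Q s a - M.qValue π s a) (fun D hD s a => ?_) s a)⟩
  have hπ : ∀ s', ∑ a', π.1 s' a' * M.qValue π s' a' = M.qValue π s' (g s') := fun s' => by
    simp [π, Pi.single_apply]
  have h1 := mul_le_mul_of_nonneg_left (sum_mul_le_of_mem_stdSimplex (M.trans_mem s a)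
    (f := fun s' => maxValue Q s' - M.qValue π s' (g s')) (c := D)
    fun s' => by rw [hg]; exact hD s' (g s')) M.γ_mem.1
  simp only [mul_sub, Finset.sum_sub_distrib] at h1
  have h2 : Q s a = _ := (congrFun (congrFun hQ s) a).symm
  have h3 := M.qValue_eq π s a
  simp_rw [hπ] at h3
  rw [optimalityOperator] at h2
  linarith

lemma optimalityOperator_qStar [Nonempty A] : M.optimalityOperator M.qStar = M.qStar := by
  obtain ⟨Q, hQ⟩ := M.exists_optimality_fixedPoint
  obtain ⟨π, hπ⟩ := M.exists_policy_ge_of_fixedPoint hQ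
  have : M.qStar = Q := by
    funext s a
    have : Nonempty (Policy S A) := ⟨π⟩
    refine le_antisymm (ciSup_le fun π' => M.qValue_le_of_fixedPoint hQ π' s a) ?_
    exact (hπ s a).trans (le_ciSup (f := fun π' => M.qValue π' s a)
      ⟨1 / (1 - M.γ), Set.forall_mem_range.2 fun π' => M.qValue_le π' s a⟩ π)
  rw [this, hQ]

/-- The Bellman optimality equation. -/
lemma qStar_eq [Nonempty A] (s : S) (a : A) :
    M.qStar s a = M.reward s a + M.γ * ∑ s', M.trans s a s' * maxValue M.qStar s' :=
  (congrFun (congrFun M.optimalityOperator_qStar s) a).symm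

lemma qStar_nonneg (s : S) (a : A) : 0 ≤ M.qStar s a :=
  Real.iSup_nonneg fun π => M.qValue_nonneg π s a

lemma qStar_le (s : S) (a : A) : M.qStar s a ≤ 1 / (1 - M.γ) :=
  Real.iSup_le (fun π => M.qValue_le π s a) (one_div_nonneg.2 (sub_nonneg.2 M.γ_mem.2.le))

lemma maxValue_qStar_mem [Nonempty A] (s : S) :
    maxValue M.qStar s ∈ Set.Icc (0 : ℝ) (1 / (1 - M.γ)) := by
  obtain ⟨a, ha⟩ := exists_eq_maxValue M.qStar s
  rw [ha]
  exact ⟨M.qStar_nonneg s a, M.qStar_le s a⟩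

end FederatedMDP

/-! ### Scalar recursions -/

lemma linear_recursion {q : ℝ} {d c : ℕ → ℝ} (h : ∀ n, d (n + 1) = q * d n + c n) (n : ℕ) :
    d n = q ^ n * d 0 + ∑ j ∈ Finset.range n, q ^ (n - 1 - j) * c j := by
  induction n with
  | zero => simp
  | succ n ih =>
    rw [h, ih, Finset.sum_range_succ, mul_add, Finset.mul_sum, pow_succ]
    have : ∀ j ∈ Finset.range n, q * (q ^ (n - 1 - j) * c j) = q ^ (n + 1 - 1 - j) * c j := by
      intro j hj
      rw [← mul_assoc, ← pow_succ']
      congr 2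
      have := Finset.mem_range.1 hj
      omega
    rw [Finset.sum_congr rfl this]
    simp only [add_tsub_cancel_right, tsub_self, pow_zero, one_mul]
    ring

lemma sum_pow_mul_one_sub (q : ℝ) (n : ℕ) :
    ∑ j ∈ Finset.range n, q ^ (n - 1 - j) * (1 - q) = 1 - q ^ n := by
  have := linear_recursion (q := q) (d := fun _ => 1) (c := fun _ => 1 - q) (fun _ => by ring) n
  linarith

/-- If each term of a geometrically weighted sum is at most `G`, so is the normalized sum. -/
lemma abs_sum_pow_mul_le {q G : ℝ} (hq : 0 ≤ q) {g : ℕ → ℝ} {n : ℕ}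
    (hg : ∀ j < n, |g j| ≤ (1 - q) * G) :
    |∑ j ∈ Finset.range n, q ^ (n - 1 - j) * g j| ≤ (1 - q ^ n) * G := by
  rw [← sum_pow_mul_one_sub q n, Finset.sum_mul]
  refine (Finset.abs_sum_le_sum_abs _ _).trans (Finset.sum_le_sum fun j hj => ?_)
  rw [abs_mul, abs_of_nonneg (pow_nonneg hq _), mul_assoc]
  exact mul_le_mul_of_nonneg_left (hg j (Finset.mem_range.1 hj)) (pow_nonneg hq _)

/-- The discounted renewal inequality behind the contraction of the error: a perturbation `B + γ c`
is amplified by `1 / (1 - γ)`, and the initial error decays at the rate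
`q + γ (1 - q) = 1 - (1 - q) (1 - γ)`. -/
lemma renewal_bound {q γ B c : ℝ} (hq0 : 0 ≤ q) (hq1 : q ≤ 1) (hγ0 : 0 ≤ γ) (hγ1 : γ < 1)
    (hB : 0 ≤ B) (hc : 0 ≤ c) {d : ℕ → ℝ} {R : ℕ}
    (h : ∀ r ≤ R, d r ≤ q ^ r * d 0 + B +
      γ * ∑ i ∈ Finset.range r, q ^ (r - 1 - i) * ((1 - q) * (d i + c))) :
    ∀ r ≤ R, d r ≤ (B + γ * c) / (1 - γ) + (1 - (1 - q) * (1 - γ)) ^ r * d 0 := by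
  have h1γ : 0 < 1 - γ := sub_pos.2 hγ1
  set b := (B + γ * c) / (1 - γ) with hb
  set ρ := 1 - (1 - q) * (1 - γ) with hρ
  have hb0 : 0 ≤ b := by positivity
  have hbeq : b * (1 - γ) = B + γ * c := div_mul_cancel₀ _ h1γ.ne'
  intro r
  induction r using Nat.strong_induction_on with
  | _ r ih =>
    intro hr
    have h1 : ∑ i ∈ Finset.range r, q ^ (r - 1 - i) * ((1 - q) * (d i + c)) ≤
        ∑ i ∈ Finset.range r, q ^ (r - 1 - i) * ((1 - q) * (b + ρ ^ i * d 0 + c)) := by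
      refine Finset.sum_le_sum fun i hi => mul_le_mul_of_nonneg_left
        (mul_le_mul_of_nonneg_left ?_ (sub_nonneg.2 hq1)) (pow_nonneg hq0 _)
      have hi' := Finset.mem_range.1 hi
      linarith [ih i hi' (hi'.le.trans hr)]
    have h2 : γ * ∑ i ∈ Finset.range r, q ^ (r - 1 - i) * ((1 - q) * (b + ρ ^ i * d 0 + c)) =
        γ * (1 - q ^ r) * (b + c) + (ρ ^ r - q ^ r) * d 0 := by
      have h3 := linear_recursion (q := q) (d := fun n => ρ ^ n)
        (c := fun n => γ * (1 - q) * ρ ^ n) (fun n => by rw [pow_succ, hρ]; ring) r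
      rw [pow_zero, mul_one] at h3
      rw [h3, add_sub_cancel_left, ← sum_pow_mul_one_sub, Finset.mul_sum, Finset.mul_sum,
        Finset.sum_mul, Finset.sum_mul, ← Finset.sum_add_distrib]
      exact Finset.sum_congr rfl fun i _ => by ring
    have h4 : γ * (1 - q ^ r) * (b + c) ≤ γ * (b + c) := by
      have := mul_nonneg (mul_nonneg hγ0 (pow_nonneg hq0 r)) (add_nonneg hb0 hc)
      linarith
    have h5 := h r hr
    have h6 := mul_le_mul_of_nonneg_left h1 hγ0
    linarith

namespace FederatedMDP

variable {S : Type u} {A : Type v} [Fintype S] [Fintype A] {N : ℕ} (M : FederatedMDP S A N)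

/-! ### Averaging over the agents -/

lemma agentCount_pos (s : S) : 0 < M.agentCount s := by
  classical
  obtain ⟨k, hk⟩ := M.cover s
  exact Finset.card_pos.2 ⟨k, by simpa using hk⟩

lemma aggregate_const (Q : S → A → ℝ) (s : S) (a : A) : M.aggregate (fun _ => Q) s a = Q s a := by
  have h : (M.agentCount s : ℝ) ≠ 0 := Nat.cast_ne_zero.2 (M.agentCount_pos s).ne'
  rw [aggregate, ← Finset.sum_filter, Finset.sum_const, nsmul_eq_mul, ← mul_assoc]
  convert one_mul (Q s a)
  exact one_div_mul_cancel h

lemma aggregate_sub (P Q : Fin N → S → A → ℝ) (s : S) (a : A) :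
    M.aggregate (fun k s a => P k s a - Q k s a) s a =
      M.aggregate P s a - M.aggregate Q s a := by
  simp only [aggregate, ← mul_sub, ← Finset.sum_sub_distrib]
  congr 2 with k
  split_ifs <;> simp

lemma aggregate_add (P Q : Fin N → S → A → ℝ) (s : S) (a : A) :
    M.aggregate (fun k s a => P k s a + Q k s a) s a =
      M.aggregate P s a + M.aggregate Q s a := by
  simp only [aggregate, ← mul_add, ← Finset.sum_add_distrib]
  congr 2 with k
  split_ifs <;> simp

lemma abs_aggregate_le {Q : Fin N → S → A → ℝ} {s : S} {a : A} {c : ℝ}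
    (h : ∀ k, s ∈ M.region k → |Q k s a| ≤ c) : |M.aggregate Q s a| ≤ c := by
  rw [← M.aggregate_const (fun _ _ => c) s a, aggregate, aggregate, abs_mul,
    abs_of_nonneg (by positivity)]
  refine mul_le_mul_of_nonneg_left ((Finset.abs_sum_le_sum_abs _ _).trans
    (Finset.sum_le_sum fun k _ => ?_)) (by positivity)
  split_ifs with hk
  · exact h k hk
  · simp

variable [Nonempty A]

/-! ### Error decomposition along the algorithm -/

/-- The sampling error, for the optimal value function, of the next state `y` drawn at `(s, a)`. -/
def sampleNoise (s : S) (a : A) (y : S) : ℝ :=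
  ∑ s', M.trans s a s' * maxValue M.qStar s' - maxValue M.qStar y

/-- The discounted noise that agent `k` accumulates at the pair `p` during `n` local steps. -/
def localNoise (η : ℝ) (k : Fin N) (y : ℕ → M.LocalPair k → S) (n : ℕ) (p : M.LocalPair k) : ℝ :=
  ∑ j ∈ Finset.range n, (1 - η) ^ (n - 1 - j) * (η * M.γ * M.sampleNoise p.1.1 p.2 (y j p))

lemma localRun_of_notMem (η : ℝ) (k : Fin N) (y : ℕ → M.LocalPair k → S) (Q : S → A → ℝ) (n : ℕ)
    {s : S} (hs : s ∉ M.region k) (a : A) : M.localRun η k y Q n s a = Q s a := by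
  induction n with
  | zero => rfl
  | succ n ih => rw [localRun, localStep, dif_neg hs, ih]

/-- Inside its region, the error of an agent consists of the discounted initial error, the noise,
and the discounted errors of the sampled next states. -/
lemma qStar_sub_localRun (η : ℝ) (k : Fin N) (y : ℕ → M.LocalPair k → S) (Q : S → A → ℝ) (n : ℕ)
    {s : S} (hs : s ∈ M.region k) (a : A) :
    M.qStar s a - M.localRun η k y Q n s a =
      (1 - η) ^ n * (M.qStar s a - Q s a) + M.localNoise η k y n (⟨s, hs⟩, a) +
      ∑ j ∈ Finset.range n, (1 - η) ^ (n - 1 - j) * (η * (M.γ *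
        (maxValue M.qStar (y j (⟨s, hs⟩, a)) -
          maxValue (M.localRun η k y Q j) (y j (⟨s, hs⟩, a))))) := by
  have h := linear_recursion (q := 1 - η) (d := fun n => M.qStar s a - M.localRun η k y Q n s a)
    (c := fun j => η * M.γ * M.sampleNoise s a (y j (⟨s, hs⟩, a)) + η * (M.γ *
        (maxValue M.qStar (y j (⟨s, hs⟩, a)) -
          maxValue (M.localRun η k y Q j) (y j (⟨s, hs⟩, a))))) (fun n => by
      rw [localRun, localStep, dif_pos hs, sampleNoise, M.qStar_eq s a]
      ring) n
  rw [h, localNoise, add_assoc, ← Finset.sum_add_distrib]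
  simp only [mul_add, localRun]

/-- The part of the local error that stems from the errors of the sampled next states. -/
lemma abs_qStar_sub_localRun_sub_le {η : ℝ} (hη0 : 0 ≤ η) (hη1 : η ≤ 1) (k : Fin N)
    (y : ℕ → M.LocalPair k → S) (Q : S → A → ℝ) {n : ℕ} {D : ℝ}
    (hD : ∀ j < n, ∀ s a, |M.qStar s a - M.localRun η k y Q j s a| ≤ D)
    {s : S} (hs : s ∈ M.region k) (a : A) :
    |M.qStar s a - M.localRun η k y Q n s a -
      ((1 - η) ^ n * (M.qStar s a - Q s a) + M.localNoise η k y n (⟨s, hs⟩, a))| ≤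
      (1 - (1 - η) ^ n) * (M.γ * D) := by
  rw [M.qStar_sub_localRun η k y Q n hs a, add_sub_cancel_left]
  refine abs_sum_pow_mul_le (sub_nonneg.2 hη1) fun j hj => ?_
  rw [sub_sub_cancel, abs_mul, abs_mul, abs_of_nonneg hη0, abs_of_nonneg M.γ_mem.1]
  exact mul_le_mul_of_nonneg_left (mul_le_mul_of_nonneg_left
    (abs_maxValue_sub_le fun a' => hD j hj _ a') M.γ_mem.1) hη0

/-- During a short period without communication the error of an agent grows by at most `4 / 3` of
its noise. -/
lemma abs_qStar_sub_localRun_le {η : ℝ} (hη0 : 0 ≤ η) (hη1 : η ≤ 1) (k : Fin N)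
    (y : ℕ → M.LocalPair k → S) (Q : S → A → ℝ) {B : ℝ} (hB : 0 ≤ B) {n : ℕ}
    (hn : M.γ * (η * n) ≤ 1 / 4) (hnoise : ∀ e ≤ n, ∀ p, |M.localNoise η k y e p| ≤ B)
    (s : S) (a : A) :
    |M.qStar s a - M.localRun η k y Q n s a| ≤ ‖M.qStar - Q‖ + 4 / 3 * B := by
  induction n using Nat.strong_induction_on generalizing s a with
  | _ n ih =>
    have h0 : |M.qStar s a - Q s a| ≤ ‖M.qStar - Q‖ := abs_apply_le_norm (M.qStar - Q) s a
    by_cases hs : s ∈ M.region k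
    · have hq0 : 0 ≤ (1 - η) ^ n := pow_nonneg (sub_nonneg.2 hη1) n
      have hq1 : (1 - η) ^ n ≤ 1 := pow_le_one₀ (sub_nonneg.2 hη1) (by linarith)
      have hx : 1 - (1 - η) ^ n ≤ η * n := by
        have := one_add_mul_le_pow (a := -η) (by linarith) n
        rw [← sub_eq_add_neg] at this
        linarith
      have h1 := M.abs_qStar_sub_localRun_sub_le hη0 hη1 k y Q (n := n)
        (D := ‖M.qStar - Q‖ + 4 / 3 * B) (fun j hj => ih j hj
          (hn.trans' (by have := M.γ_mem.1; gcongr)) fun e he => hnoise e (he.trans hj.le)) hs a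
      have h2 := hnoise n le_rfl (⟨s, hs⟩, a)
      have h3 : |(1 - η) ^ n * (M.qStar s a - Q s a)| ≤ (1 - η) ^ n * ‖M.qStar - Q‖ := by
        rw [abs_mul, abs_of_nonneg hq0]
        exact mul_le_mul_of_nonneg_left h0 hq0
      have h4 : M.γ * (1 - (1 - η) ^ n) ≤ 1 / 4 :=
        (mul_le_mul_of_nonneg_left hx M.γ_mem.1).trans hn
      have h5 : (1 - (1 - η) ^ n) * (M.γ * (‖M.qStar - Q‖ + 4 / 3 * B)) ≤
          (1 - (1 - η) ^ n) * ‖M.qStar - Q‖ + 1 / 3 * B := by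
        have h6 := mul_le_mul_of_nonneg_right h4 hB
        have h7 := mul_le_mul_of_nonneg_right M.γ_mem.2.le
          (mul_nonneg (sub_nonneg.2 hq1) (norm_nonneg (M.qStar - Q)))
        linarith
      rw [abs_le] at *
      constructor <;> linarith
    · rw [localRun_of_notMem _ _ _ _ _ _ hs]
      linarith

open Classical in
/-- The average over the agents of the noise that they accumulate in round `r`. -/
def roundNoise (η : ℝ) (E : ℕ) (x : ℕ × M.Slot → S) (r : ℕ) : S → A → ℝ :=
  M.aggregate fun k s a => if h : s ∈ M.region k then
    M.localNoise η k (fun e p => x (r * E + e, ⟨k, p⟩)) E (⟨s, h⟩, a) else 0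

/-- The discounted noise of the averaged Q function after `R` rounds. -/
def globalNoise (η : ℝ) (E : ℕ) (x : ℕ × M.Slot → S) (R : ℕ) (s : S) (a : A) : ℝ :=
  ∑ r ∈ Finset.range R, ((1 - η) ^ E) ^ (R - 1 - r) * M.roundNoise η E x r s a

/-- One communication round: up to the averaged noise and the discounted errors of the sampled next
states, the error is multiplied by `(1 - η) ^ E`. -/
lemma abs_round_error_le {η : ℝ} (hη0 : 0 ≤ η) (hη1 : η ≤ 1) {E : ℕ} (x : ℕ × M.Slot → S)
    (Q₀ : S → A → ℝ) (r : ℕ) {D : ℝ}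
    (hD : ∀ k, ∀ e < E, ∀ s a, |M.qStar s a - M.localRun η k
      (fun e p => x (r * E + e, ⟨k, p⟩)) (M.fedQSynQ η E x Q₀ r) e s a| ≤ D) (s : S) (a : A) :
    |M.qStar s a - M.fedQSynQ η E x Q₀ (r + 1) s a -
      ((1 - η) ^ E * (M.qStar s a - M.fedQSynQ η E x Q₀ r s a) + M.roundNoise η E x r s a)| ≤
      (1 - (1 - η) ^ E) * (M.γ * D) := by
  rw [fedQSynQ, roundNoise, ← M.aggregate_const M.qStar s a, ← M.aggregate_const
    (fun s a => (1 - η) ^ E * (M.aggregate (fun _ => M.qStar) s a - M.fedQSynQ η E x Q₀ r s a)) s a,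
    ← aggregate_sub, ← aggregate_add, ← aggregate_sub]
  refine M.abs_aggregate_le fun k hk => ?_
  rw [aggregate_const, dif_pos hk]
  exact M.abs_qStar_sub_localRun_sub_le hη0 hη1 k _ _ (hD k) hk a

/-- On the event that all local noises are at most `B₁` and all global noises at most `B₂`, the
error is at most `(B₂ + γ (4 / 3) B₁) / (1 - γ)` plus the decayed initial error. -/
theorem norm_qStar_sub_fedQSynQ_le {η : ℝ} (hη0 : 0 ≤ η) (hη1 : η ≤ 1) {E R : ℕ}
    (x : ℕ × M.Slot → S) (Q₀ : S → A → ℝ) {B₁ B₂ : ℝ} (hB₁ : 0 ≤ B₁) (hB₂ : 0 ≤ B₂)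
    (hE : M.γ * (η * ((E : ℝ) - 1)) ≤ 1 / 4)
    (hlocal : ∀ r < R, ∀ e < E, ∀ k p,
      |M.localNoise η k (fun e p => x (r * E + e, ⟨k, p⟩)) e p| ≤ B₁)
    (hglobal : ∀ r ≤ R, ∀ s a, |M.globalNoise η E x r s a| ≤ B₂) :
    ‖M.qStar - M.fedQSynQ η E x Q₀ R‖ ≤ (B₂ + M.γ * (4 / 3 * B₁)) / (1 - M.γ) +
      (1 - (1 - (1 - η) ^ E) * (1 - M.γ)) ^ R * ‖M.qStar - Q₀‖ := by
  have hγ0 := M.γ_mem.1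
  have hq0 : 0 ≤ (1 - η) ^ E := pow_nonneg (sub_nonneg.2 hη1) E
  have hq1 : (1 - η) ^ E ≤ 1 := pow_le_one₀ (sub_nonneg.2 hη1) (by linarith)
  set q := (1 - η) ^ E with hq
  refine renewal_bound (d := fun r => ‖M.qStar - M.fedQSynQ η E x Q₀ r‖) (c := 4 / 3 * B₁)
    hq0 hq1 hγ0 M.γ_mem.2 hB₂ (by positivity) (fun r hr => ?_) R le_rfl
  refine norm_le_of_abs_le (add_nonneg (by positivity) (mul_nonneg hγ0 (Finset.sum_nonneg
    fun i _ => mul_nonneg (pow_nonneg hq0 _) (mul_nonneg (sub_nonneg.2 hq1)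
      (by positivity))))) fun s a => ?_
  have h1 := linear_recursion (q := q)
    (d := fun n => M.qStar s a - M.fedQSynQ η E x Q₀ n s a)
    (c := fun n => M.qStar s a - M.fedQSynQ η E x Q₀ (n + 1) s a -
      q * (M.qStar s a - M.fedQSynQ η E x Q₀ n s a)) (fun n => by ring) r
  have h2 : ∀ i ∈ Finset.range r, |q ^ (r - 1 - i) * (M.qStar s a - M.fedQSynQ η E x Q₀ (i + 1) s a
      - q * (M.qStar s a - M.fedQSynQ η E x Q₀ i s a)) -
      q ^ (r - 1 - i) * M.roundNoise η E x i s a| ≤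
      M.γ * (q ^ (r - 1 - i) * ((1 - q) * (‖M.qStar - M.fedQSynQ η E x Q₀ i‖ + 4 / 3 * B₁))) := by
    intro i hi
    have hi' := (Finset.mem_range.1 hi).trans_le hr
    have h3 := M.abs_round_error_le hη0 hη1 x Q₀ i
      (D := ‖M.qStar - M.fedQSynQ η E x Q₀ i‖ + 4 / 3 * B₁) (fun k e he s a =>
        M.abs_qStar_sub_localRun_le hη0 hη1 k _ _ hB₁ (hE.trans' (by
          have : (e : ℝ) + 1 ≤ E := by exact_mod_cast he
          gcongr
          linarith)) (fun e' he' => hlocal i hi' e' (he'.trans_lt he) k) s a) s a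
    rw [← mul_sub, abs_mul, abs_of_nonneg (pow_nonneg hq0 _), mul_left_comm]
    refine mul_le_mul_of_nonneg_left ?_ (pow_nonneg hq0 _)
    rw [sub_sub, mul_left_comm]
    exact h3
  have h4 := (Finset.abs_sum_le_sum_abs _ _).trans (Finset.sum_le_sum h2)
  rw [Finset.sum_sub_distrib, ← Finset.mul_sum] at h4
  have h5 := hglobal r hr s a
  rw [globalNoise, ← hq] at h5
  have h6 : |q ^ r * (M.qStar s a - Q₀ s a)| ≤ q ^ r * ‖M.qStar - Q₀‖ := by
    rw [abs_mul, abs_of_nonneg (pow_nonneg hq0 _)]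
    exact mul_le_mul_of_nonneg_left (abs_apply_le_norm (M.qStar - Q₀) s a) (pow_nonneg hq0 _)
  rw [Pi.sub_apply, Pi.sub_apply, h1]
  change |q ^ r * (M.qStar s a - Q₀ s a) + _| ≤ q ^ r * ‖M.qStar - Q₀‖ + _ + _
  rw [abs_le] at *
  constructor <;> linarith

end FederatedMDP

/-! ### Concentration of the noise -/

/-- A sub-Gaussian variable is sub-Gaussian for every larger parameter. -/
lemma hasSubgaussianMGF_mono {Ω : Type*} [MeasurableSpace Ω] {μ : Measure Ω} {Y : Ω → ℝ}
    {c c' : NNReal} (h : HasSubgaussianMGF Y c μ) (hc : (c : ℝ) ≤ c') :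
    HasSubgaussianMGF Y c' μ :=
  ⟨h.integrable_exp_mul, fun t => (h.mgf_le t).trans (by gcongr)⟩

namespace FederatedMDP

variable {S : Type u} {A : Type v} [Fintype S] [Fintype A] [Nonempty A] {N : ℕ}
variable (M : FederatedMDP S A N)

open Classical in
/-- The global noise as one weighted sum over rounds, local steps, and agents that see `s`. -/
lemma globalNoise_eq_sum (η : ℝ) (E : ℕ) (x : ℕ × M.Slot → S) (R : ℕ) (s : S) (a : A) :
    M.globalNoise η E x R s a =
      ∑ i ∈ Finset.range R ×ˢ (Finset.univ : Finset (Fin E × {k // s ∈ M.region k})),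
        ((1 - η) ^ E) ^ (R - 1 - i.1) * ((1 - η) ^ (E - 1 - (i.2.1 : ℕ)) * η) *
          (M.γ / M.agentCount s) *
          M.sampleNoise s a (x (i.1 * E + i.2.1, ⟨i.2.2.1, (⟨s, i.2.2.2⟩, a)⟩)) := by
  rw [Finset.sum_product, globalNoise]
  refine Finset.sum_congr rfl fun r _ => ?_
  rw [roundNoise, aggregate, ← Finset.sum_filter, Finset.sum_subtype
    (p := fun k => s ∈ M.region k) _ (fun k => by simp), Fintype.sum_prod_type,
    Finset.sum_comm, Finset.mul_sum, Finset.mul_sum]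
  refine Finset.sum_congr rfl fun k _ => ?_
  rw [dif_pos k.2, localNoise, Finset.sum_range, Finset.mul_sum, Finset.mul_sum]
  exact Finset.sum_congr rfl fun e _ => by ring

section Concentration

variable [MeasurableSpace S] [MeasurableSingletonClass S] {Ω : Type w} [MeasurableSpace Ω]
  {μ : Measure Ω} [IsProbabilityMeasure μ] {X : ℕ × M.Slot → Ω → S}

/-- By Hoeffding's lemma the sampling errors are sub-Gaussian: they are centered and lie in an
interval of length `1 / (1 - γ)`. -/
lemma hasSubgaussianMGF_sampleNoise (hX : M.IsSampleFamily μ X) (i : ℕ × M.Slot) :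
    HasSubgaussianMGF (fun ω => M.sampleNoise i.2.2.1.1 i.2.2.2 (X i ω))
      ((‖1 / (1 - M.γ)‖₊ / 2) ^ 2) μ := by
  obtain ⟨t, k, p⟩ := i
  set m := ∑ s', M.trans p.1.1 p.2 s' * maxValue M.qStar s' with hm
  have hmeas : Measurable fun ω => maxValue M.qStar (X (t, ⟨k, p⟩) ω) :=
    (measurable_of_finite (maxValue M.qStar)).comp (hX.measurable _)
  have hint : ∫ ω, maxValue M.qStar (X (t, ⟨k, p⟩) ω) ∂μ = m := by
    have := integral_map (μ := μ) (hX.measurable (t, ⟨k, p⟩)).aemeasurable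
      (f := maxValue M.qStar) (measurable_of_finite _).aestronglyMeasurable
    rw [← this, integral_fintype (Integrable.of_finite), hm]
    refine Finset.sum_congr rfl fun s' _ => ?_
    rw [map_measureReal_apply (hX.measurable _) (measurableSet_singleton s'), hX.law, smul_eq_mul]
  have h := (hasSubgaussianMGF_of_mem_Icc (μ := μ) hmeas.aemeasurable
    (Filter.Eventually.of_forall fun ω => M.maxValue_qStar_mem (X (t, ⟨k, p⟩) ω))).neg
  rw [hint, sub_zero] at h
  refine h.congr (Filter.Eventually.of_forall fun ω => ?_)
  simp [sampleNoise, hm]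

/-- Hoeffding's inequality for weighted sums of sampling errors. -/
lemma measureReal_weightedNoise_le (hX : M.IsSampleFamily μ X) {ι : Type*} (I : Finset ι)
    {g : ι → ℕ × M.Slot} (hg : Function.Injective g) (c : ι → ℝ) {τ b : ℝ}
    (hτ : ∑ i ∈ I, c i ^ 2 ≤ τ) (hb : 0 ≤ b) :
    μ.real {ω | b ≤ |∑ i ∈ I, c i * M.sampleNoise (g i).2.2.1.1 (g i).2.2.2 (X (g i) ω)|} ≤
      2 * Real.exp (-(2 * b ^ 2 * (1 - M.γ) ^ 2 / τ)) := by
  set Z : Ω → ℝ := fun ω =>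
    ∑ i ∈ I, c i * M.sampleNoise (g i).2.2.1.1 (g i).2.2.2 (X (g i) ω) with hZ
  have hγ : 0 < 1 - M.γ := sub_pos.2 M.γ_mem.2
  have hτ0 : 0 ≤ τ := (Finset.sum_nonneg fun i _ => sq_nonneg (c i)).trans hτ
  have hindep : iIndepFun (fun i ω =>
      c i * M.sampleNoise (g i).2.2.1.1 (g i).2.2.2 (X (g i) ω)) μ :=
    (hX.indep.precomp hg).comp
      (fun i y => c i * M.sampleNoise (g i).2.2.1.1 (g i).2.2.2 y) fun i => measurable_of_finite _
  have h0 := HasSubgaussianMGF.sum_of_iIndepFun hindep (s := I)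
    (c := fun i => Real.toNNReal (c i ^ 2 / (2 * (1 - M.γ)) ^ 2)) fun i _ => by
      refine hasSubgaussianMGF_mono ((M.hasSubgaussianMGF_sampleNoise hX (g i)).const_mul (c i)) ?_
      rw [Real.coe_toNNReal _ (by positivity)]
      refine (NNReal.coe_mul _ _).trans_le (le_of_eq ?_)
      change c i ^ 2 * _ = _
      simp only [NNReal.coe_pow, NNReal.coe_div, coe_nnnorm, Real.norm_eq_abs, NNReal.coe_ofNat,
        div_pow, sq_abs]
      field_simp
  -- Chernoff's bound in Mathlib is trivial for the parameter `0`, the case of vanishing weights;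
  -- hence the passage to the parameter that belongs to `τ`
  have h1 : HasSubgaussianMGF Z (Real.toNNReal (τ / (2 * (1 - M.γ)) ^ 2)) μ := by
    refine hasSubgaussianMGF_mono h0 ?_
    rw [Real.coe_toNNReal _ (by positivity), NNReal.coe_sum]
    simp_rw [Real.coe_toNNReal _ (div_nonneg (sq_nonneg (c _)) (sq_nonneg (2 * (1 - M.γ))))]
    rw [← Finset.sum_div]
    gcongr
  have h2 : ∀ {Y : Ω → ℝ}, HasSubgaussianMGF Y (Real.toNNReal (τ / (2 * (1 - M.γ)) ^ 2)) μ →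
      μ.real {ω | b ≤ Y ω} ≤ Real.exp (-(2 * b ^ 2 * (1 - M.γ) ^ 2 / τ)) := by
    intro Y hY
    refine (hY.measure_ge_le hb).trans_eq ?_
    rw [Real.coe_toNNReal _ (by positivity)]
    congr 1
    field_simp
  have hsub : {ω | b ≤ |Z ω|} ⊆ {ω | b ≤ Z ω} ∪ {ω | b ≤ (-Z) ω} := fun ω hω =>
    (le_abs (a := b) (b := Z ω)).1 hω
  calc μ.real {ω | b ≤ |Z ω|} ≤ _ := measureReal_mono hsub
    _ ≤ _ := measureReal_union_le _ _
    _ ≤ _ := by rw [two_mul]; exact add_le_add (h2 h1) (h2 h1.neg)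

lemma measureReal_localNoise_le (hX : M.IsSampleFamily μ X) {η : ℝ} (hη0 : 0 ≤ η) (hη1 : η ≤ 1)
    (E r n : ℕ) (k : Fin N) (p : M.LocalPair k) {τ b : ℝ} (hτ : η ^ 2 * n ≤ τ) (hb : 0 ≤ b) :
    μ.real {ω | b ≤ |M.localNoise η k (fun e p => X (r * E + e, ⟨k, p⟩) ω) n p|} ≤
      2 * Real.exp (-(2 * b ^ 2 * (1 - M.γ) ^ 2 / τ)) := by
  have h := M.measureReal_weightedNoise_le hX (Finset.range n) (g := fun j => (r * E + j, ⟨k, p⟩))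
    (fun i j hij => by simpa using hij) (fun j => (1 - η) ^ (n - 1 - j) * (η * M.γ))
    (τ := τ) (b := b) (hτ.trans' ?_) hb
  · simpa only [localNoise, mul_assoc] using h
  · calc _ ≤ ∑ j ∈ Finset.range n, η ^ 2 := Finset.sum_le_sum fun j _ => ?_
      _ = _ := by rw [Finset.sum_const, Finset.card_range, nsmul_eq_mul, mul_comm]
    have hγ := M.γ_mem
    have h0 : 0 ≤ (1 - η) ^ (n - 1 - j) := pow_nonneg (sub_nonneg.2 hη1) _
    have h1 : (1 - η) ^ (n - 1 - j) ≤ 1 := pow_le_one₀ (sub_nonneg.2 hη1) (by linarith)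
    refine pow_le_pow_left₀ (mul_nonneg h0 (mul_nonneg hη0 hγ.1)) ?_ 2
    calc _ ≤ 1 * (η * 1) := mul_le_mul h1 (mul_le_mul_of_nonneg_left hγ.2.le hη0)
          (mul_nonneg hη0 hγ.1) zero_le_one
      _ = η := by ring

lemma measureReal_globalNoise_le (hX : M.IsSampleFamily μ X) {η : ℝ} (hη0 : 0 ≤ η) (hη1 : η ≤ 1)
    (E R : ℕ) (s : S) (a : A) {τ b : ℝ} (hτ : η / M.agentCount s ≤ τ) (hb : 0 ≤ b) :
    μ.real {ω | b ≤ |M.globalNoise η E (fun i => X i ω) R s a|} ≤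
      2 * Real.exp (-(2 * b ^ 2 * (1 - M.γ) ^ 2 / τ)) := by
  classical
  have hg : Function.Injective fun i : ℕ × Fin E × {k // s ∈ M.region k} =>
      ((i.1 * E + i.2.1, ⟨i.2.2.1, (⟨s, i.2.2.2⟩, a)⟩) : ℕ × M.Slot) := by
    rintro ⟨r, e, k, hk⟩ ⟨r', e', k', hk'⟩ h
    have h1 : r * E + (e : ℕ) = r' * E + e' := congrArg Prod.fst h
    have h2 : k = k' := congrArg (fun i => i.2.1) h
    have hE : 0 < E := e.pos
    have h3 : r = r' := by
      have := congrArg (· / E) h1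
      simpa [Nat.add_comm _ (e : ℕ), Nat.add_comm _ (e' : ℕ), Nat.add_mul_div_right _ _ hE,
        Nat.div_eq_of_lt e.2, Nat.div_eq_of_lt e'.2] using this
    subst h2 h3
    have h4 : e = e' := Fin.ext (Nat.add_left_cancel h1)
    rw [h4]
  have h := M.measureReal_weightedNoise_le hX
    (Finset.range R ×ˢ (Finset.univ : Finset (Fin E × {k // s ∈ M.region k}))) hg
    (fun i => ((1 - η) ^ E) ^ (R - 1 - i.1) * ((1 - η) ^ (E - 1 - (i.2.1 : ℕ)) * η) *
          (M.γ / M.agentCount s)) (τ := τ) (b := b) (hτ.trans' ?_) hb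
  · simpa only [globalNoise_eq_sum] using h
  have hγ := M.γ_mem
  have hq0 : 0 ≤ 1 - η := sub_nonneg.2 hη1
  have hq1 : 1 - η ≤ 1 := by linarith
  have hn : (0 : ℝ) < M.agentCount s := Nat.cast_pos.2 (M.agentCount_pos s)
  calc _ ≤ ∑ i ∈ Finset.range R ×ˢ (Finset.univ : Finset (Fin E × {k // s ∈ M.region k})),
        ((1 - η) ^ E) ^ (R - 1 - i.1) * ((1 - η) ^ (E - 1 - (i.2.1 : ℕ)) * (1 - (1 - η))) *
          (η / M.agentCount s ^ 2) := Finset.sum_le_sum fun i _ => ?_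
    _ = (1 - ((1 - η) ^ E) ^ R) * (η / M.agentCount s) := by
        have hcard : (Fintype.card {k // s ∈ M.region k} : ℝ) = M.agentCount s := by
          rw [Fintype.card_subtype, agentCount]
        rw [← Finset.sum_mul, Finset.sum_product]
        simp only [Fintype.sum_prod_type, Finset.sum_const, Finset.card_univ, nsmul_eq_mul, hcard]
        simp only [← Finset.mul_sum, ← Finset.sum_range
          (fun e => (1 - η) ^ (E - 1 - e) * (1 - (1 - η))), sum_pow_mul_one_sub]
        field_simp
    _ ≤ η / M.agentCount s := mul_le_of_le_one_left (by positivity)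
        (sub_le_self _ (pow_nonneg (pow_nonneg hq0 _) _))
  set w₁ := ((1 - η) ^ E) ^ (R - 1 - i.1)
  set w₂ := (1 - η) ^ (E - 1 - (i.2.1 : ℕ))
  have h10 : 0 ≤ w₁ := pow_nonneg (pow_nonneg hq0 _) _
  have h11 : w₁ ≤ 1 := pow_le_one₀ (pow_nonneg hq0 _) (pow_le_one₀ hq0 hq1)
  have h20 : 0 ≤ w₂ := pow_nonneg hq0 _
  have h21 : w₂ ≤ 1 := pow_le_one₀ hq0 hq1
  have hγ2 : M.γ ^ 2 ≤ 1 := pow_le_one₀ hγ.1 hγ.2.le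
  calc (w₁ * (w₂ * η) * (M.γ / M.agentCount s)) ^ 2
      = (w₁ * w₁) * (w₂ * w₂) * M.γ ^ 2 * (η * (η / M.agentCount s ^ 2)) := by
        field_simp
    _ ≤ (w₁ * 1) * (w₂ * 1) * 1 * (η * (η / M.agentCount s ^ 2)) := by gcongr
    _ = _ := by ring

end Concentration

end FederatedMDP

/-! ### Accuracy for admissible parameters -/

/-- The contraction exponent of a round: `E` local steps are worth at least `η E / 2` as long as
`η (E - 1) ≤ 1`. -/
lemma half_mul_le_one_sub_pow {η : ℝ} (hη0 : 0 ≤ η) (hη1 : η ≤ 1) {E : ℕ} (hE : 1 ≤ E)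
    (h : η * ((E : ℝ) - 1) ≤ 1) : η * E / 2 ≤ 1 - (1 - η) ^ E := by
  obtain ⟨n, rfl⟩ : ∃ n, E = n + 1 := ⟨E - 1, by omega⟩
  push_cast at h ⊢
  rw [add_sub_cancel_right] at h
  have hq : 0 ≤ 1 - η := sub_nonneg.2 hη1
  have h1 : (1 - η) ^ n * (1 + η * n) ≤ 1 := by
    have h2 : 1 + η * n ≤ (1 + η) ^ n := by
      have := one_add_mul_le_pow (a := η) (by linarith) n
      linarith
    calc _ ≤ (1 - η) ^ n * (1 + η) ^ n := mul_le_mul_of_nonneg_left h2 (pow_nonneg hq n)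
      _ = (1 - η * η) ^ n := by rw [← mul_pow]; ring
      _ ≤ 1 := pow_le_one₀ (by nlinarith) (by nlinarith)
  have h3 := mul_le_mul_of_nonneg_left h1 hq
  have h4 : 0 ≤ 1 - (1 - η) ^ (n + 1) := sub_nonneg.2 (pow_le_one₀ hq (by linarith))
  have h5 := mul_le_mul_of_nonneg_left h h4
  rw [pow_succ] at *
  linarith

lemma two_le_log {x : ℝ} (hx : 10 ≤ x) : 2 ≤ Real.log x := by
  rw [Real.le_log_iff_exp_le (by linarith)]
  have h := Real.exp_one_lt_d9
  have h1 : Real.exp 2 = Real.exp 1 ^ 2 := by rw [← Real.exp_nat_mul]; norm_num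
  have h0 := Real.exp_pos 1
  rw [h1]
  nlinarith

lemma ten_le_ten_div {γ ε : ℝ} (hγ : γ ∈ Set.Ico (0 : ℝ) 1) (hε : ε ∈ Set.Ioo 0 (1 / (1 - γ))) :
    10 ≤ 10 / (ε * (1 - γ) ^ 2) := by
  have hh : 0 < 1 - γ := sub_pos.2 hγ.2
  have h1 : ε * (1 - γ) < 1 := (lt_div_iff₀ hh).1 hε.2
  have h2 : 0 < ε * (1 - γ) := mul_pos hε.1 hh
  rw [le_div_iff₀ (by have := hε.1; positivity)]
  nlinarith [hγ.1]

namespace FederatedMDP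

variable {S : Type u} {A : Type v} [Fintype S] [Fintype A] {N : ℕ} (M : FederatedMDP S A N)

lemma minCount_le [Nonempty S] (s : S) : M.minCount ≤ M.agentCount s :=
  Finset.inf'_le _ (Finset.mem_univ s)

lemma minCount_pos [Nonempty S] : 0 < M.minCount :=
  (Finset.lt_inf'_iff _).2 fun s _ => M.agentCount_pos s

lemma card_slot_le : Fintype.card M.Slot ≤ N * (Fintype.card S * Fintype.card A) := by
  rw [Fintype.card_sigma]
  refine (Finset.sum_le_card_nsmul _ _ (Fintype.card S * Fintype.card A) fun k _ => ?_).trans_eq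
    (by simp)
  rw [Fintype.card_prod, Fintype.card_coe]
  exact Nat.mul_le_mul_right _ (Finset.card_le_univ _)

/-- Union bound: with high probability all local and all global noises are at most `b`. -/
lemma measureReal_noise_bounded_ge [Nonempty S] [Nonempty A] [MeasurableSpace S]
    [MeasurableSingletonClass S] {Ω : Type w} [MeasurableSpace Ω] {μ : Measure Ω}
    [IsProbabilityMeasure μ] {X : ℕ × M.Slot → Ω → S} (hX : M.IsSampleFamily μ X)
    {η : ℝ} (hη0 : 0 ≤ η) (hη1 : η ≤ 1) {E R : ℕ}
    (hE : η * ((E : ℝ) - 1) * M.minCount ≤ 1) {b : ℝ} (hb : 0 ≤ b) :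
    1 - (R * (E * Fintype.card M.Slot) + (R + 1) * (Fintype.card S * Fintype.card A)) *
        (2 * Real.exp (-(2 * b ^ 2 * (1 - M.γ) ^ 2 / (η / M.minCount)))) ≤
      μ.real {ω | (∀ r < R, ∀ e < E, ∀ k p,
          |M.localNoise η k (fun e p => X (r * E + e, ⟨k, p⟩) ω) e p| ≤ b) ∧
        ∀ r ≤ R, ∀ s a, |M.globalNoise η E (fun i => X i ω) r s a| ≤ b} := by
  set G := {ω | (∀ r < R, ∀ e < E, ∀ k p,
          |M.localNoise η k (fun e p => X (r * E + e, ⟨k, p⟩) ω) e p| ≤ b) ∧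
        ∀ r ≤ R, ∀ s a, |M.globalNoise η E (fun i => X i ω) r s a| ≤ b} with hG
  set P := 2 * Real.exp (-(2 * b ^ 2 * (1 - M.γ) ^ 2 / (η / M.minCount))) with hP
  have hm : (0 : ℝ) < M.minCount := Nat.cast_pos.2 M.minCount_pos
  let F₁ : Fin R × Fin E × M.Slot → Set Ω := fun i => {ω | b ≤ |M.localNoise η i.2.2.1
    (fun e p => X (i.1 * E + e, ⟨i.2.2.1, p⟩) ω) i.2.1 i.2.2.2|}
  let F₂ : Fin (R + 1) × S × A → Set Ω := fun i =>
    {ω | b ≤ |M.globalNoise η E (fun i => X i ω) i.1 i.2.1 i.2.2|}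
  have h₁ : ∀ i, μ.real (F₁ i) ≤ P := fun i => by
    refine M.measureReal_localNoise_le hX hη0 hη1 E i.1 i.2.1 i.2.2.1 i.2.2.2 ?_ hb
    have h1 : ((i.2.1 : ℕ) : ℝ) ≤ (E : ℝ) - 1 := by
      have : ((i.2.1 : ℕ) : ℝ) + 1 ≤ E := by exact_mod_cast i.2.1.2
      linarith
    rw [le_div_iff₀ hm]
    calc η ^ 2 * (i.2.1 : ℕ) * M.minCount ≤ η ^ 2 * ((E : ℝ) - 1) * M.minCount := by gcongr
      _ = η * (η * ((E : ℝ) - 1) * M.minCount) := by ring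
      _ ≤ η := mul_le_of_le_one_right hη0 hE
  have h₂ : ∀ i, μ.real (F₂ i) ≤ P := fun i =>
    M.measureReal_globalNoise_le hX hη0 hη1 E i.1 i.2.1 i.2.2
      (div_le_div_of_nonneg_left hη0 hm (Nat.cast_le.2 (M.minCount_le _))) hb
  have hcover : (Set.univ : Set Ω) ⊆ G ∪ ((⋃ i, F₁ i) ∪ ⋃ i, F₂ i) := by
    intro ω _
    by_cases hω : ω ∈ G
    · exact Or.inl hω
    refine Or.inr ?_
    by_contra hn
    simp only [Set.mem_union, Set.mem_iUnion, not_or, not_exists] at hn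
    refine hω ⟨fun r hr e he k p => ?_, fun r hr s a => ?_⟩
    · exact (not_le.1 (hn.1 (⟨r, hr⟩, ⟨e, he⟩, ⟨k, p⟩))).le
    · exact (not_le.1 (hn.2 (⟨r, Nat.lt_succ_of_le hr⟩, s, a))).le
  have hU₁ : μ.real (⋃ i, F₁ i) ≤ R * (E * Fintype.card M.Slot) * P := by
    refine (measureReal_iUnion_fintype_le F₁).trans
      ((Finset.sum_le_card_nsmul _ _ P fun i _ => h₁ i).trans_eq ?_)
    simp
  have hU₂ : μ.real (⋃ i, F₂ i) ≤ (R + 1) * (Fintype.card S * Fintype.card A) * P := by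
    refine (measureReal_iUnion_fintype_le F₂).trans
      ((Finset.sum_le_card_nsmul _ _ P fun i _ => h₂ i).trans_eq ?_)
    simp
  have h1 : (1 : ℝ) ≤ μ.real (G ∪ ((⋃ i, F₁ i) ∪ ⋃ i, F₂ i)) := by
    rw [← probReal_univ (μ := μ)]
    exact measureReal_mono hcover
  have h2 := measureReal_union_le (μ := μ) G ((⋃ i, F₁ i) ∪ ⋃ i, F₂ i)
  have h3 := measureReal_union_le (μ := μ) (⋃ i, F₁ i) (⋃ i, F₂ i)
  linarith

/-- Every admissible choice of the parameters reaches the accuracy. -/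
theorem reachesAccuracy_of_admissibleParams [Nonempty S] [Nonempty A] [MeasurableSpace S]
    [MeasurableSingletonClass S] {Q₀ : S → A → ℝ} {ε δ η : ℝ} {E R : ℕ}
    (hQ₀ : ∀ s a, 0 ≤ Q₀ s a ∧ Q₀ s a ≤ 1 / (1 - M.γ)) (hε : ε ∈ Set.Ioo 0 (1 / (1 - M.γ)))
    (hδ : δ ∈ Set.Ioo (0 : ℝ) 1)
    (h : AdmissibleParams (Fintype.card S) (Fintype.card A) N M.minCount M.γ ε δ η E R) :
    M.ReachesAccuracy.{u, v, w} Q₀ ε δ η E R := by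
  intro Ω _ μ _ X hX
  have hη0 := h.eta_pos
  have hη1 := h.eta_le_one
  have hγ := M.γ_mem
  have hε0 := hε.1
  have hh : 0 < 1 - M.γ := sub_pos.2 hγ.2
  have hm : (1 : ℝ) ≤ M.minCount := by exact_mod_cast M.minCount_pos
  have hE : (1 : ℝ) ≤ E := by exact_mod_cast h.E_pos
  have hR : (1 : ℝ) ≤ R := by exact_mod_cast h.R_pos
  have hS : (1 : ℝ) ≤ Fintype.card S := by exact_mod_cast Fintype.card_pos
  have hA : (1 : ℝ) ≤ Fintype.card A := by exact_mod_cast Fintype.card_pos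
  have hN : (1 : ℝ) ≤ N := by
    obtain ⟨k, -⟩ := M.cover (Classical.arbitrary S)
    exact_mod_cast k.pos
  have hE1 : 0 ≤ η * ((E : ℝ) - 1) := mul_nonneg hη0.le (sub_nonneg.2 hE)
  have hEm : η * ((E : ℝ) - 1) * M.minCount ≤ 1 := by
    have := h.E_le_Nmin
    have := mul_nonneg hE1 (zero_le_one.trans hm)
    linarith
  have hE2 : η * ((E : ℝ) - 1) ≤ 1 := (le_mul_of_one_le_right hE1 hm).trans hEm
  have hEγ : M.γ * (η * ((E : ℝ) - 1)) ≤ 1 / 4 := by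
    have := h.E_le_gamma
    have := mul_nonneg hγ.1 hE1
    linarith [hγ.1]
  have hT_ge := h.eta_ge
  have hη_le := h.eta_le
  push_cast at hT_ge hη_le
  set Lδ := Real.log (6 * Fintype.card S * Fintype.card A * (E * R) * N / δ) with hLδ
  set Lε := Real.log (10 / (ε * (1 - M.γ) ^ 2)) with hLε
  have hcnt : 1 ≤ Fintype.card S * Fintype.card A * (E * R : ℝ) * N :=
    one_le_mul_of_one_le_of_one_le (one_le_mul_of_one_le_of_one_le
      (one_le_mul_of_one_le_of_one_le hS hA) (one_le_mul_of_one_le_of_one_le hE hR)) hN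
  have harg : 1 < 6 * Fintype.card S * Fintype.card A * (E * R) * N / δ := by
    rw [lt_div_iff₀ hδ.1]
    linarith [hδ.2]
  have hLδ0 : 0 < Lδ := Real.log_pos harg
  have hLε2 : 2 ≤ Lε := two_le_log (ten_le_ten_div hγ hε)
  set b := ε * (1 - M.γ) / 4 with hb
  have hb0 : 0 ≤ b := by positivity
  -- the deviation `b` has probability at most `2 exp (-Lδ)`
  have hexp : Real.exp (-(2 * b ^ 2 * (1 - M.γ) ^ 2 / (η / M.minCount))) ≤
      δ / (6 * Fintype.card S * Fintype.card A * (E * R) * N) := by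
    rw [← inv_div _ δ, ← Real.exp_log (zero_lt_one.trans harg), ← Real.exp_neg, Real.exp_le_exp,
      neg_le_neg_iff, ← hLδ, le_div_iff₀ (by positivity), hb]
    rw [← div_eq_mul_inv, le_div_iff₀ hLδ0] at hη_le
    rw [← mul_div_assoc, div_le_iff₀ (by positivity)]
    have : 0 ≤ M.minCount * ε ^ 2 * (1 - M.γ) ^ 4 := by positivity
    linarith
  refine le_trans ?_ ((M.measureReal_noise_bounded_ge hX hη0.le hη1 (R := R) hEm hb0).trans
    (measureReal_mono fun ω hω => ?_))
  · have hslot : (Fintype.card M.Slot : ℝ) ≤ N * (Fintype.card S * Fintype.card A) := by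
      exact_mod_cast M.card_slot_le
    have hsum : (R * (E * Fintype.card M.Slot) + (R + 1) * (Fintype.card S * Fintype.card A) : ℝ) ≤
        3 * (Fintype.card S * Fintype.card A * (E * R) * N) := by
      have h1 : (R * (E * Fintype.card M.Slot) : ℝ) ≤
          R * (E * (N * (Fintype.card S * Fintype.card A))) := by gcongr
      have h2 : (R + 1 : ℝ) * (Fintype.card S * Fintype.card A) ≤
          2 * (E * R * N) * (Fintype.card S * Fintype.card A) := by
        have h3 : (R : ℝ) ≤ E * R * N := (le_mul_of_one_le_left (by positivity) hE).trans
          (le_mul_of_one_le_right (by positivity) hN)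
        gcongr
        linarith
      linarith
    have := mul_le_mul hsum (mul_le_mul_of_nonneg_left hexp zero_le_two) (by positivity)
      (by positivity)
    refine sub_le_sub_left (this.trans_eq ?_) 1
    field_simp
    ring
  · have hdet := M.norm_qStar_sub_fedQSynQ_le hη0.le hη1 (fun i => X i ω) Q₀ hb0 hb0 hEγ
      hω.1 hω.2
    refine hdet.trans ?_
    have hinit : ‖M.qStar - Q₀‖ ≤ 1 / (1 - M.γ) :=
      norm_le_of_abs_le (by positivity) fun s a => by
        have h1 := M.qStar_nonneg s a
        have h2 := M.qStar_le s a
        have h3 := hQ₀ s a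
        exact abs_le.2 ⟨by simp only [Pi.sub_apply]; linarith,
          by simp only [Pi.sub_apply]; linarith⟩
    set α := 1 - (1 - η) ^ E with hα
    have hαE : η * E / 2 ≤ α := half_mul_le_one_sub_pow hη0.le hη1 h.E_pos hE2
    have hα1 : α ≤ 1 := sub_le_self _ (pow_nonneg (sub_nonneg.2 hη1) _)
    have hα0 : 0 ≤ α := (by positivity : (0:ℝ) ≤ η * E / 2).trans hαE
    have hdecay : (1 - α * (1 - M.γ)) ^ R ≤ ε * (1 - M.γ) ^ 2 / 10 := by
      have h1 : 1 - α * (1 - M.γ) ≤ Real.exp (-(α * (1 - M.γ))) := by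
        have := Real.add_one_le_exp (-(α * (1 - M.γ)))
        linarith
      have h0 : 0 ≤ 1 - α * (1 - M.γ) := by
        have := mul_le_one₀ hα1 hh.le (by linarith [hγ.1] : 1 - M.γ ≤ 1)
        linarith
      have h2 : Lε ≤ R * (α * (1 - M.γ)) := by
        rw [div_le_iff₀ (by positivity)] at hT_ge
        have h3 : η * ((1 - M.γ) * (E * R)) / 2 ≤ R * (α * (1 - M.γ)) := by
          have := mul_le_mul_of_nonneg_right hαE (by positivity : 0 ≤ (1 - M.γ) * R)
          linarith
        have h4 := mul_le_mul_of_nonneg_right hLε2 (zero_le_two.trans hLε2)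
        linarith
      calc (1 - α * (1 - M.γ)) ^ R ≤ Real.exp (-(α * (1 - M.γ))) ^ R := pow_le_pow_left₀ h0 h1 R
        _ = Real.exp (-(R * (α * (1 - M.γ)))) := by rw [← Real.exp_nat_mul]; ring_nf
        _ ≤ Real.exp (-Lε) := Real.exp_le_exp.2 (neg_le_neg h2)
        _ = ε * (1 - M.γ) ^ 2 / 10 := by
          rw [Real.exp_neg, hLε, Real.exp_log (by positivity), inv_div]
    have h1 : (b + M.γ * (4 / 3 * b)) / (1 - M.γ) ≤ 7 / 12 * ε := by
      rw [div_le_iff₀ hh, hb]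
      have : M.γ * (ε * (1 - M.γ)) ≤ ε * (1 - M.γ) :=
        mul_le_of_le_one_left (by positivity) hγ.2.le
      linarith
    have h2 : (1 - α * (1 - M.γ)) ^ R * ‖M.qStar - Q₀‖ ≤ ε / 10 := by
      calc _ ≤ ε * (1 - M.γ) ^ 2 / 10 * (1 / (1 - M.γ)) :=
            mul_le_mul hdecay hinit (norm_nonneg _) (by positivity)
        _ = ε * (1 - M.γ) / 10 := by field_simp
        _ ≤ ε / 10 := by
          have := mul_le_of_le_one_right hε0.le (by linarith [hγ.1] : 1 - M.γ ≤ 1)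
          linarith
    linarith

end FederatedMDP

/-! ### The choice of the parameters -/

/-- The logarithm in the conditions on `T` and `η` is of the order of the logarithmic factor `Λ`,
for every `T` up to `2 * 10 ^ 5 * Λ ^ 3 * W`, where `W` is the rate of `T`. -/
lemma log_sampleCount_le {n δ y W Λ T : ℝ} (hn : 1 ≤ n) (hδ : δ ∈ Set.Ioo (0 : ℝ) 1) (hy : 1 ≤ y)
    (hW : W ≤ y ^ 3) (hΛ : Λ = Real.log (10 * n / δ * y)) (hT0 : 0 < T)
    (hT : T ≤ 2 * 10 ^ 5 * Λ ^ 3 * W) : Real.log (6 * n * T / δ) ≤ 10 ^ 5 * Λ / 1296 := by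
  have hδ0 := hδ.1
  have hd : 10 ≤ 10 * n / δ := by
    rw [le_div_iff₀ hδ0]
    nlinarith [hδ.2]
  have hz : 10 ≤ 10 * n / δ * y := hd.trans (le_mul_of_one_le_right (by linarith) hy)
  have hΛ2 : 2 ≤ Λ := hΛ ▸ two_le_log hz
  have hK : Real.log (12 * 10 ^ 5) ≤ 15 := by
    rw [Real.log_le_iff_le_exp (by norm_num)]
    have h1 : Real.exp 15 = Real.exp 1 ^ 15 := by rw [← Real.exp_nat_mul]; norm_num
    rw [h1]
    calc (12 * 10 ^ 5 : ℝ) ≤ 2.7 ^ 15 := by norm_num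
      _ ≤ Real.exp 1 ^ 15 :=
        pow_le_pow_left₀ (by norm_num) (by linarith [Real.exp_one_gt_d9]) 15
  have harg : 6 * n * T / δ ≤ 12 * 10 ^ 5 * Λ ^ 3 * (10 * n / δ * y) ^ 3 := by
    have h1 : T ≤ 2 * 10 ^ 5 * Λ ^ 3 * y ^ 3 := hT.trans (by gcongr)
    have h2 : n / δ ≤ (10 * n / δ) ^ 3 := by
      have h3 : n / δ ≤ 10 * n / δ := by
        gcongr
        linarith
      exact h3.trans (le_self_pow₀ (by linarith) (by norm_num))
    calc 6 * n * T / δ = 6 * (n / δ) * T := by ring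
      _ ≤ 6 * (10 * n / δ) ^ 3 * (2 * 10 ^ 5 * Λ ^ 3 * y ^ 3) := by gcongr
      _ = _ := by ring
  have hlogΛ : Real.log Λ ≤ Λ := (Real.log_le_sub_one_of_pos (by linarith)).trans (by linarith)
  calc Real.log (6 * n * T / δ) ≤ Real.log (12 * 10 ^ 5 * Λ ^ 3 * (10 * n / δ * y) ^ 3) :=
        Real.log_le_log (by positivity) harg
    _ = Real.log (12 * 10 ^ 5) + 3 * Real.log Λ + 3 * Λ := by
        rw [Real.log_mul (by positivity) (by positivity), Real.log_mul (by norm_num)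
          (by positivity), Real.log_pow, Real.log_pow, ← hΛ]
        norm_num
    _ ≤ 15 + 3 * Λ + 3 * Λ := by gcongr
    _ ≤ 10 ^ 5 * Λ / 1296 := by
        norm_num
        linarith

/-- Splitting about `T₀` iterations into rounds with the largest number `E` of local steps that
satisfies `1.01 η (E - 1) ≤ ν / 4`. -/
lemma exists_period_rounds {η ν T₀ : ℝ} (hη : 0 < η) (hν : 0 ≤ ν) (hT₀ : 2 ≤ T₀)
    (h : ν ≤ 2 * η * T₀) : ∃ E R : ℕ, 1 ≤ E ∧ 1 ≤ R ∧ 1.01 * η * ((E : ℝ) - 1) ≤ ν / 4 ∧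
      ν ≤ 4.04 * η * E ∧ T₀ ≤ E * R ∧ (E * R : ℝ) ≤ 2 * T₀ ∧ (R : ℝ) ≤ T₀ / E + 1 := by
  set n := ⌊ν / (4 * (1.01 * η))⌋₊ with hn
  have hn1 : (n : ℝ) * (4 * (1.01 * η)) ≤ ν :=
    (le_div_iff₀ (by positivity)).1 (Nat.floor_le (by positivity))
  have hn2 : ν ≤ ((n : ℝ) + 1) * (4 * (1.01 * η)) :=
    (div_le_iff₀ (by positivity)).1 (Nat.lt_floor_add_one _).le
  have hE0 : (0 : ℝ) < n + 1 := by positivity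
  have hnT₀ : (n : ℝ) ≤ T₀ / 2 := by
    refine le_of_mul_le_mul_right ?_ (by positivity : (0 : ℝ) < 4 * (1.01 * η))
    have : 0 ≤ η * T₀ := by positivity
    linarith
  have hR1 : T₀ ≤ ((n : ℝ) + 1) * ⌈T₀ / (n + 1)⌉₊ := by
    have := (div_le_iff₀ hE0).1 (Nat.le_ceil (T₀ / (n + 1)))
    rwa [mul_comm] at this
  have hR2 : (⌈T₀ / (n + 1)⌉₊ : ℝ) ≤ T₀ / (n + 1) + 1 := (Nat.ceil_lt_add_one (by positivity)).le
  refine ⟨n + 1, ⌈T₀ / (n + 1)⌉₊, Nat.le_add_left 1 n, Nat.one_le_ceil_iff.2 (by positivity), ?_⟩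
  push_cast
  refine ⟨by linarith, by linarith, hR1, ?_, hR2⟩
  calc ((n : ℝ) + 1) * ⌈T₀ / (n + 1)⌉₊ ≤ (n + 1) * (T₀ / (n + 1) + 1) := by gcongr
    _ = T₀ + (n + 1) := by field_simp
    _ ≤ 2 * T₀ := by linarith

set_option maxHeartbeats 400000 in
/-- With `m = Nmin ε² (1 - γ)⁴` and `Λ` the logarithmic factor, the step size `min m 1 / (10⁵ Λ)`,
the largest local period that it allows, and about `10⁵ Λ³ / ((1 - γ) min m 1)` iterations are
admissible and have the asserted rates. -/
theorem exists_admissibleParams (nS nA N Nmin : ℕ) (γ ε δ : ℝ) (hS : 1 ≤ nS) (hA : 1 ≤ nA)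
    (hNmin : 1 ≤ Nmin) (hN : Nmin ≤ N) (hγ : γ ∈ Set.Ico (0 : ℝ) 1)
    (hε : ε ∈ Set.Ioo 0 (1 / (1 - γ))) (hδ : δ ∈ Set.Ioo (0 : ℝ) 1) :
    ∃ (η : ℝ) (E R : ℕ),
      AdmissibleParams nS nA N Nmin γ ε δ η E R ∧
      ((E * R : ℕ) : ℝ) ≤ 2 * 10 ^ 5 * logFactor nS nA N γ ε δ ^ 3 *
        max (1 / (Nmin * ε ^ 2 * (1 - γ) ^ 5)) (1 / (1 - γ)) ∧
      min (Nmin * ε ^ 2 * (1 - γ) ^ 4) 1 ≤ 2 * 10 ^ 5 * logFactor nS nA N γ ε δ ^ 3 * η ∧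
      1 / (Nmin * ε ^ 2 * (1 - γ) ^ 4) * min (1 - γ) (1 / Nmin) ≤
        2 * 10 ^ 5 * logFactor nS nA N γ ε δ ^ 3 * E ∧
      (R : ℝ) ≤ 2 * 10 ^ 5 * logFactor nS nA N γ ε δ ^ 3 *
        (1 / (1 - γ) * max (1 / (1 - γ)) Nmin) := by
  have hε0 := hε.1
  have hδ0 := hδ.1
  have hS' : (1 : ℝ) ≤ nS := by exact_mod_cast hS
  have hA' : (1 : ℝ) ≤ nA := by exact_mod_cast hA
  have hM' : (1 : ℝ) ≤ Nmin := by exact_mod_cast hNmin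
  have hN' : (1 : ℝ) ≤ N := by exact_mod_cast hNmin.trans hN
  have h10 := ten_le_ten_div hγ hε
  set h := 1 - γ with hh
  have hh0 : 0 < h := sub_pos.2 hγ.2
  have hh1 : h ≤ 1 := by linarith [hγ.1]
  have hεh : ε * h < 1 := (lt_div_iff₀ hh0).1 hε.2
  set m := Nmin * ε ^ 2 * h ^ 4 with hm
  have hm0 : 0 < m := by positivity
  set m₁ := min m 1 with hm₁
  have hm₁0 : 0 < m₁ := lt_min hm0 one_pos
  have hm₁m : m₁ ≤ m := min_le_left _ _
  have hm₁1 : m₁ ≤ 1 := min_le_right _ _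
  set W := max (1 / (Nmin * ε ^ 2 * h ^ 5)) (1 / h) with hWdef
  have hmh : Nmin * ε ^ 2 * h ^ 5 = h * m := by rw [hm]; ring
  have hW : W = 1 / (h * m₁) := by
    rw [hWdef, hmh, hm₁]
    rcases le_total m 1 with h1 | h1
    · rw [min_eq_left h1, max_eq_left]
      exact one_div_le_one_div_of_le (by positivity) (mul_le_of_le_one_right hh0.le h1)
    · rw [min_eq_right h1, mul_one, max_eq_right]
      exact one_div_le_one_div_of_le hh0 (le_mul_of_one_le_right hh0.le h1)
  set y := 1 / (ε * h ^ 2) with hy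
  have hhy : 1 / h ≤ y := one_div_le_one_div_of_le (by positivity) (by nlinarith)
  have hy1 : 1 ≤ y := ((one_le_div hh0).2 hh1).trans hhy
  have hWy : W ≤ y ^ 3 := by
    refine max_le ?_ (hhy.trans (le_self_pow₀ hy1 (by norm_num)))
    calc 1 / (Nmin * ε ^ 2 * h ^ 5) ≤ 1 / (1 * ε ^ 2 * h ^ 5) := by gcongr
      _ = y ^ 2 * (1 / h) := by rw [hy]; field_simp
      _ ≤ y ^ 2 * y := by gcongr
      _ = y ^ 3 := by ring
  set Λ := logFactor nS nA N γ ε δ with hΛdef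
  have hn : (1 : ℝ) ≤ nS * nA * N :=
    one_le_mul_of_one_le_of_one_le (one_le_mul_of_one_le_of_one_le hS' hA') hN'
  have hΛ : Λ = Real.log (10 * (nS * nA * N) / δ * y) := by
    rw [hΛdef, logFactor, hy, ← hh]
    congr 1
    field_simp
  set Lε := Real.log (10 / (ε * h ^ 2)) with hLε
  have hLε2 : 2 ≤ Lε := two_le_log h10
  have hLΛ : Lε ≤ Λ := by
    rw [hΛ, hLε]
    refine Real.log_le_log (by positivity) ?_
    have h1 : 10 ≤ 10 * (nS * nA * N) / δ := by
      rw [le_div_iff₀ hδ0]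
      nlinarith [hδ.2]
    calc 10 / (ε * h ^ 2) = 10 * y := by rw [hy]; ring
      _ ≤ _ := by gcongr
  have hΛ2 : 2 ≤ Λ := hLε2.trans hLΛ
  have hΛ0 : 0 < Λ := by linarith
  have hΛ3 : Λ ≤ Λ ^ 3 := le_self_pow₀ (by linarith) (by norm_num)
  set η := m₁ / (10 ^ 5 * Λ) with hη
  have hη0 : 0 < η := by positivity
  have hηm : η * (10 ^ 5 * Λ) = m₁ := div_mul_cancel₀ _ (by positivity)
  set ν := min h (1 / Nmin) with hν
  have hν0 : 0 < ν := lt_min hh0 (by positivity)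
  have hνh : ν ≤ h := min_le_left _ _
  have hνN : ν * Nmin ≤ 1 := (le_div_iff₀ (by positivity)).1 (min_le_right _ _)
  have hνinv : 1 / ν = max (1 / h) Nmin := by
    rw [hν]
    rcases le_total h (1 / Nmin) with h1 | h1
    · rw [min_eq_left h1, max_eq_left]
      rwa [le_div_iff₀ hh0, mul_comm, ← le_div_iff₀ (by positivity)]
    · rw [min_eq_right h1, one_div_one_div, max_eq_right]
      rwa [div_le_iff₀ hh0, mul_comm, ← div_le_iff₀ (by positivity)]
  set T₀ := 10 ^ 5 * Λ ^ 3 * W with hT₀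
  have hW0 : 0 < W := by rw [hW]; positivity
  have hW1 : 1 ≤ W := by
    rw [hW, le_div_iff₀ (by positivity), one_mul]
    exact mul_le_one₀ hh1 hm₁0.le hm₁1
  have hηT₀ : η * T₀ * h = Λ ^ 2 := by
    rw [hη, hT₀, hW]
    field_simp
  have hT₀2 : 2 ≤ T₀ := by
    have : 2 * 1 ≤ 10 ^ 5 * Λ ^ 3 * W := mul_le_mul (by linarith) hW1 (by norm_num) (by positivity)
    linarith
  have hνT₀ : ν ≤ 2 * η * T₀ := by
    have h1 : η * T₀ * h ≤ η * T₀ * 1 := mul_le_mul_of_nonneg_left hh1 (by positivity)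
    have h2 : 2 * 2 ≤ Λ * Λ := mul_le_mul hΛ2 hΛ2 zero_le_two hΛ0.le
    linarith
  obtain ⟨E, R, hE, hRpos, hE_sub, hE_ge, hT_ge, hT_le, hR_le⟩ :=
    exists_period_rounds hη0 hν0.le hT₀2 hνT₀
  have hE1 : (1 : ℝ) ≤ E := by exact_mod_cast hE
  have hR1 : (1 : ℝ) ≤ R := by exact_mod_cast hRpos
  have hT_le' : (E * R : ℝ) ≤ 2 * 10 ^ 5 * Λ ^ 3 * W := by rw [hT₀] at hT_le; linarith
  have hT0 : (0 : ℝ) < E * R := by positivity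
  have hL : Real.log (6 * nS * nA * (E * R) * N / δ) ≤ 10 ^ 5 * Λ / 1296 := by
    have := log_sampleCount_le hn hδ hy1 hWy hΛ hT0 hT_le'
    rwa [show 6 * (nS * nA * N : ℝ) * (E * R) = 6 * nS * nA * (E * R) * N by ring] at this
  have hL0 : 0 < Real.log (6 * nS * nA * (E * R) * N / δ) := by
    refine Real.log_pos ?_
    rw [lt_div_iff₀ hδ0, one_mul]
    have h1 : (1 : ℝ) ≤ E * R := one_le_mul_of_one_le_of_one_le hE1 hR1
    have h2 : (1 : ℝ) ≤ nS * nA * N * (E * R) := one_le_mul_of_one_le_of_one_le hn h1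
    linarith [hδ.2]
  refine ⟨η, E, R, ⟨hη0, ?_, hE, hRpos, ?_, ?_, ?_, ?_, ?_⟩, ?_, ?_, ?_, ?_⟩
  · rw [hη, div_le_one (by positivity)]
    linarith
  · push_cast
    rw [← hh, ← hLε]
    refine le_trans ?_ hT_ge
    have h1 : 1 / (Nmin * ε ^ 2 * h ^ 5) ≤ W := le_max_left _ _
    calc _ = 1296 * (1 / (Nmin * ε ^ 2 * h ^ 5)) * Lε ^ 2 *
          Real.log (6 * nS * nA * (E * R) * N / δ) := by ring
      _ ≤ 1296 * W * Λ ^ 2 * (10 ^ 5 * Λ / 1296) := by gcongr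
      _ = T₀ := by rw [hT₀]; ring
  · push_cast
    rw [← hh, ← hm, ← div_eq_mul_inv, le_div_iff₀ hL0]
    have := mul_le_mul_of_nonneg_left hL hη0.le
    linarith
  · push_cast
    rw [← hh, ← hLε, div_le_iff₀ (by positivity)]
    calc Lε ^ 2 ≤ Λ ^ 2 := by gcongr
      _ = η * (h * T₀) := by rw [← hηT₀]; ring
      _ ≤ η * (h * (E * R)) := by gcongr
  · have h1 := mul_le_mul_of_nonneg_right hE_sub (by linarith [hγ.1] : 0 ≤ 4 * γ)
    have h2 : ν * γ ≤ h * 1 := mul_le_mul hνh hγ.2.le hγ.1 hh0.le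
    linarith
  · have h1 := mul_le_mul_of_nonneg_right hE_sub (by positivity : (0 : ℝ) ≤ Nmin)
    linarith
  · push_cast
    exact hT_le'
  · rw [← hηm]
    have := mul_le_mul_of_nonneg_left hΛ3 hη0.le
    have := mul_nonneg hη0.le hΛ0.le
    linarith
  · have h1 : 1 / m * ν ≤ ν / m₁ := by
      rw [one_div_mul_eq_div]
      gcongr
    have h2 : ν / m₁ ≤ E := by
      rw [div_le_iff₀ hm₁0, ← hηm]
      refine hE_ge.trans ?_
      have := mul_le_mul_of_nonneg_left hΛ2 (by positivity : 0 ≤ E * η)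
      have : 0 ≤ E * η := by positivity
      linarith
    have h3 : (1 : ℝ) ≤ 2 * 10 ^ 5 * Λ ^ 3 := by linarith
    exact (h1.trans h2).trans (le_mul_of_one_le_left (by positivity) h3)
  · rw [← hνinv]
    have h1 : T₀ / E ≤ 4.04 * Λ ^ 2 * (1 / h * (1 / ν)) := by
      rw [div_le_iff₀ (by positivity), ← hηT₀]
      calc T₀ = T₀ * (1 / ν) * ν := by field_simp
        _ ≤ T₀ * (1 / ν) * (4.04 * η * E) := by gcongr
        _ = _ := by field_simp
    have h2 : 1 ≤ 1 / h * (1 / ν) := one_le_mul_of_one_le_of_one_le ((one_le_div hh0).2 hh1)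
      ((one_le_div hν0).2 (hνh.trans hh1))
    have h3 : 4.04 * Λ ^ 2 + 1 ≤ 2 * 10 ^ 5 * Λ ^ 3 := by
      have : Λ ^ 2 ≤ Λ ^ 3 := pow_le_pow_right₀ (by linarith) (by norm_num)
      linarith
    calc (R : ℝ) ≤ 4.04 * Λ ^ 2 * (1 / h * (1 / ν)) + 1 * (1 / h * (1 / ν)) := by linarith
      _ = (4.04 * Λ ^ 2 + 1) * (1 / h * (1 / ν)) := by ring
      _ ≤ _ := by gcongr

lemma FederatedMDP.samplesUsed_eq {S : Type u} {A : Type v} [Fintype S] [Fintype A] {N : ℕ}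
    (M : FederatedMDP S A N) (k : Fin N) (T : ℕ) :
    M.samplesUsed k T = T * ((M.region k).card * Fintype.card A) := by
  rw [samplesUsed, Fintype.card_prod, Fintype.card_prod, Fintype.card_fin, Fintype.card_coe]

end

theorem theorem2 :
    -- every admissible choice of the parameters reaches the accuracy
    (∀ (S : Type u) (A : Type v) [Fintype S] [Nonempty S] [MeasurableSpace S]
        [MeasurableSingletonClass S] [Fintype A] [Nonempty A] (N : ℕ) (M : FederatedMDP S A N)
        (Q₀ : S → A → ℝ) (ε δ η : ℝ) (E R : ℕ),
        (∀ s a, 0 ≤ Q₀ s a ∧ Q₀ s a ≤ 1 / (1 - M.γ)) →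
        ε ∈ Set.Ioo 0 (1 / (1 - M.γ)) → δ ∈ Set.Ioo (0 : ℝ) 1 →
        AdmissibleParams (Fintype.card S) (Fintype.card A) N M.minCount M.γ ε δ η E R →
        M.ReachesAccuracy.{u, v, w} Q₀ ε δ η E R) ∧
    -- and there is an admissible choice, depending on the listed numbers only, with these rates
    ∃ (C : ℝ) (p : ℕ), 0 < C ∧
      ∀ (nS nA N Nmin : ℕ) (γ ε δ : ℝ), 1 ≤ nS → 1 ≤ nA → 1 ≤ Nmin → Nmin ≤ N →
        γ ∈ Set.Ico (0 : ℝ) 1 → ε ∈ Set.Ioo 0 (1 / (1 - γ)) → δ ∈ Set.Ioo (0 : ℝ) 1 →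
        ∃ (η : ℝ) (E R : ℕ),
          AdmissibleParams nS nA N Nmin γ ε δ η E R ∧
          ((E * R : ℕ) : ℝ) ≤ C * logFactor nS nA N γ ε δ ^ p *
            max (1 / (Nmin * ε ^ 2 * (1 - γ) ^ 5)) (1 / (1 - γ)) ∧
          min (Nmin * ε ^ 2 * (1 - γ) ^ 4) 1 ≤ C * logFactor nS nA N γ ε δ ^ p * η ∧
          1 / (Nmin * ε ^ 2 * (1 - γ) ^ 4) * min (1 - γ) (1 / Nmin) ≤
            C * logFactor nS nA N γ ε δ ^ p * E ∧
          (R : ℝ) ≤ C * logFactor nS nA N γ ε δ ^ p *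
            (1 / (1 - γ) * max (1 / (1 - γ)) Nmin) ∧
          ∀ (S : Type u) (A : Type v) [Fintype S] [Nonempty S] [MeasurableSpace S]
            [MeasurableSingletonClass S] [Fintype A] [Nonempty A] (M : FederatedMDP S A N),
            Fintype.card S = nS → Fintype.card A = nA → M.minCount = Nmin → M.γ = γ →
            (∀ k : Fin N, (M.samplesUsed k (E * R) : ℝ) ≤ C * logFactor nS nA N γ ε δ ^ p *
              (((M.region k).card : ℝ) * nA *
                max (1 / (Nmin * ε ^ 2 * (1 - γ) ^ 5)) (1 / (1 - γ)))) ∧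
            ∀ Q₀ : S → A → ℝ, (∀ s a, 0 ≤ Q₀ s a ∧ Q₀ s a ≤ 1 / (1 - γ)) →
              M.ReachesAccuracy.{u, v, w} Q₀ ε δ η E R := by

  refine ⟨fun S A _ _ _ _ _ _ N M Q₀ ε δ η E R hQ₀ hε hδ h =>
      M.reachesAccuracy_of_admissibleParams hQ₀ hε hδ h,
    2 * 10 ^ 5, 3, by norm_num, fun nS nA N Nmin γ ε δ hS hA hNmin hN hγ hε hδ => ?_⟩
  obtain ⟨η, E, R, hadm, hT, hη, hE, hR⟩ :=
    exists_admissibleParams nS nA N Nmin γ ε δ hS hA hNmin hN hγ hε hδ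
  refine ⟨η, E, R, hadm, hT, hη, hE, hR, fun S A _ _ _ _ _ _ M hcS hcA hmin hMγ => ?_⟩
  subst hcS hcA hmin hMγ
  refine ⟨fun k => ?_, fun Q₀ hQ₀ => M.reachesAccuracy_of_admissibleParams hQ₀ hε hδ hadm⟩
  rw [M.samplesUsed_eq, Nat.cast_mul (E * R), Nat.cast_mul (M.region k).card]
  have := mul_le_mul_of_nonneg_right hT
    (by positivity : (0 : ℝ) ≤ (M.region k).card * Fintype.card A)
  exact this.trans_eq (by ring)
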